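/- Let $\mathbb F$ be an arbitrary field, let $d\ge 1$ be an integer and let $q\in\mathbb F$ be a primitive $d$-th root of unity. Put $\hbar=d$ if $d$ is odd and $\hbar=d/2$ if $d$ is even. Let $\triangle$ (the universal Askey–Wilson algebra) be the associative unital $\mathbb F$-algebra with generators $A,B,C,\alpha,\beta,\gamma$ and the relations that each of $\alpha,\beta,\gamma$ is central and $$CB=q^2BC+q(q^2-q^{-2})A-q(q-q^{-1})\alpha,$$ $$CA=q^{-2}AC-q^{-1}(q^2-q^{-2})B+q^{-1}(q-q^{-1})\beta,$$ $$BA=q^2AB+q(q^2-q^{-2})C-q(q-q^{-1})\gamma.$$ Let $Z(\triangle)$ denote the center of $\triangle$, and let $$\Omega=q^2+q^{-2}-qABC-q^2A^2-q^{-2}B^2-q^2C^2+qA\alpha+q^{-1}B\beta+qC\gamma .$$ Let $T_n(X)$ be the normalized Chebyshev polynomials of the first kind, given by $T_0(X)=2$, $T_1(X)=X$ and $XT_n(X)=T_{n+1}(X)+T_{n-1}(X)$ for $n\ge1$. Then: 1. The elements $$T_\hbar(A)^{i_0}\,T_\hbar(B)^{i_1}\,T_\hbar(C)^{i_2}\,\alpha^{j_0}\beta^{j_1}\gamma^{j_2}\,\Omega^{\ell},\qquad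 i_0,i_1,i_2,j_0,j_1,j_2,\ell\in\mathbb N,\ \ell<\hbar,$$ (where $0\in\mathbb N$) lie in $Z(\triangle)$ and form an $\mathbb F$-basis of $Z(\triangle)$. 2. The elements $T_\hbar(A),T_\hbar(B),T_\hbar(C),\alpha,\beta,\gamma$ lie in $Z(\triangle)$, and $Z(\triangle)$ is integral over the $\mathbb F$-subalgebra of $Z(\triangle)$ that they generate. -/

import Mathlib

/-- The six generators of the universal Askey--Wilson algebra. -/
inductive UAWGen : Type
  | A | B | C | α | β | γ

open FreeAlgebra in
/-- The defining relations: `α`, `β`, `γ` commute with all generators, together with the three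
`q`-commutation relations between `A`, `B`, `C`. -/
inductive UAWRel (F : Type*) [Field F] (q : F) :
    FreeAlgebra F UAWGen → FreeAlgebra F UAWGen → Prop
  | α_central (g : UAWGen) : UAWRel F q (ι F .α * ι F g) (ι F g * ι F .α)
  | β_central (g : UAWGen) : UAWRel F q (ι F .β * ι F g) (ι F g * ι F .β)
  | γ_central (g : UAWGen) : UAWRel F q (ι F .γ * ι F g) (ι F g * ι F .γ)
  | CB : UAWRel F q (ι F .C * ι F .B)
      (q ^ 2 • (ι F .B * ι F .C) + (q * (q ^ 2 - q⁻¹ ^ 2)) • ι F .A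
        - (q * (q - q⁻¹)) • ι F .α)
  | CA : UAWRel F q (ι F .C * ι F .A)
      (q⁻¹ ^ 2 • (ι F .A * ι F .C) - (q⁻¹ * (q ^ 2 - q⁻¹ ^ 2)) • ι F .B
        + (q⁻¹ * (q - q⁻¹)) • ι F .β)
  | BA : UAWRel F q (ι F .B * ι F .A)
      (q ^ 2 • (ι F .A * ι F .B) + (q * (q ^ 2 - q⁻¹ ^ 2)) • ι F .C
        - (q * (q - q⁻¹)) • ι F .γ)

/-- The universal Askey--Wilson algebra over `F` with parameter `q`. -/
def UAW (F : Type*) [Field F] (q : F) : Type _ := RingQuot (UAWRel F q)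

noncomputable instance (F : Type*) [Field F] (q : F) : Ring (UAW F q) :=
  inferInstanceAs (Ring (RingQuot (UAWRel F q)))

noncomputable instance (F : Type*) [Field F] (q : F) : Algebra F (UAW F q) :=
  inferInstanceAs (Algebra F (RingQuot (UAWRel F q)))

namespace UAW

noncomputable section

variable (F : Type*) [Field F] (q : F)

/-- The quotient map from the free algebra. -/
def mk : FreeAlgebra F UAWGen →ₐ[F] UAW F q := RingQuot.mkAlgHom F (UAWRel F q)

/-- The image of a generator in the universal Askey--Wilson algebra. -/
def gen (g : UAWGen) : UAW F q := mk F q (FreeAlgebra.ι F g)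

def A : UAW F q := gen F q .A
def B : UAW F q := gen F q .B
def C : UAW F q := gen F q .C
def α : UAW F q := gen F q .α
def β : UAW F q := gen F q .β
def γ : UAW F q := gen F q .γ

/-- The normalized Casimir element. -/
def Ω : UAW F q :=
  algebraMap F (UAW F q) (q ^ 2 + q⁻¹ ^ 2)
    - q • (A F q * B F q * C F q)
    - q ^ 2 • A F q ^ 2 - q⁻¹ ^ 2 • B F q ^ 2 - q ^ 2 • C F q ^ 2
    + q • (A F q * α F q) + q⁻¹ • (B F q * β F q) + q • (C F q * γ F q)

/-- `T_n(x)` for the normalized Chebyshev polynomials of the first kind `T_n`, given by `T_0 = 2`,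
`T_1 = X`, `X T_n = T_{n+1} + T_{n-1}` (Mathlib's `Polynomial.Chebyshev.C`). -/
def T (n : ℕ) (x : UAW F q) : UAW F q :=
  Polynomial.aeval x (Polynomial.Chebyshev.C F (n : ℤ))

/-- The number `đ`: equal to `d` if `d` is odd and to `d / 2` if `d` is even. -/
def dbar (d : ℕ) : ℕ := if Even d then d / 2 else d

/-- The monomial `T_n(A)^{i₀} T_n(B)^{i₁} T_n(C)^{i₂} α^{j₀} β^{j₁} γ^{j₂} Ω^ℓ`. -/
def monomial (n i₀ i₁ i₂ j₀ j₁ j₂ ℓ : ℕ) : UAW F q :=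
  T F q n (A F q) ^ i₀ * T F q n (B F q) ^ i₁ * T F q n (C F q) ^ i₂
    * α F q ^ j₀ * β F q ^ j₁ * γ F q ^ j₂ * Ω F q ^ ℓ

/-- The set `{T_n(A), T_n(B), T_n(C), α, β, γ}`. -/
def sixElements (n : ℕ) : Set (UAW F q) :=
  {T F q n (A F q), T F q n (B F q), T F q n (C F q), α F q, β F q, γ F q}

/-- The `F`-subalgebra of the center generated by those central elements that belong to
`{T_n(A), T_n(B), T_n(C), α, β, γ}`. -/
def centralSubalgebra (n : ℕ) : Subalgebra F (Subalgebra.center F (UAW F q)) :=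
  Algebra.adjoin F {z | (z : UAW F q) ∈ sixElements F q n}

end

end UAW

/-!
Let `X` and `Y` be the left and the right multiplication by `A`. The polynomial
`Y² - (q² + q⁻²) X Y + X² + (q² - q⁻²)²` in them sends `B` and `C` to elements commuting with `A`,
that is, into the kernel of `Y - X`. Its zero locus is parametrised by `X = u + u⁻¹`,
`Y = q² u + q⁻² u⁻¹`, where `T_n(Y) = T_n(X)` as soon as `q ^ (2 * n) = 1`; hence its product with
`Y - X` divides `T_n(Y) - T_n(X)`, and `T_n(A)` is central.

The ordered monomials in the generators form a basis: they span because the generators commute with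
each other up to scalars and shorter words, and they are independent because the algebra acts on
polynomials. If `q²` is a primitive `n`-th root of unity, comparing the leading terms of `z * g` and
`g * z` for the generators `g` shows that the exponents of `A`, `B` and `C` in a leading term of a
central element `z` agree modulo `n`. Such exponents are those of a unique product of powers of
`T_n(A) ~ A ^ n`, `T_n(B) ~ B ^ n`, `T_n(C) ~ C ^ n`, `α`, `β`, `γ` and `Ω ~ -q A B C` in which the
exponent of `Ω` is less than `n`. Hence these products are independent and, by induction on the
degree, span the center, which is therefore finite over the subalgebra generated without `Ω`.
-/

/-- Six elements of an `F`-algebra satisfying the relations of the universal Askey--Wilson algebra,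
written in the form that is invariant under the cyclic permutation `a → b → c → a`,
`α → β → γ → α`. This symmetry lets every statement about `a` be transported to `b` and `c`. -/
structure IsAskeyWilsonTriple {F K : Type*} [Field F] [Ring K] [Algebra F K] (q : F)
    (a b c α β γ : K) : Prop where
  comm_α (x : K) : Commute α x
  comm_β (x : K) : Commute β x
  comm_γ (x : K) : Commute γ x
  b_mul_a : b * a = q ^ 2 • (a * b) + (q * (q ^ 2 - q⁻¹ ^ 2)) • c - (q * (q - q⁻¹)) • γ
  c_mul_b : c * b = q ^ 2 • (b * c) + (q * (q ^ 2 - q⁻¹ ^ 2)) • a - (q * (q - q⁻¹)) • α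
  a_mul_c : a * c = q ^ 2 • (c * a) + (q * (q ^ 2 - q⁻¹ ^ 2)) • b - (q * (q - q⁻¹)) • β

/-- The normalized Casimir expression in six elements of an algebra. -/
def askeyWilsonCasimir {F K : Type*} [Field F] [Ring K] [Algebra F K] (q : F)
    (a b c α β γ : K) : K :=
  algebraMap F K (q ^ 2 + q⁻¹ ^ 2) - q • (a * b * c)
    - q ^ 2 • a ^ 2 - q⁻¹ ^ 2 • b ^ 2 - q ^ 2 • c ^ 2
    + q • (a * α) + q⁻¹ • (b * β) + q • (c * γ)

namespace AskeyWilson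

variable {F K : Type*} [Field F] [Ring K] [Algebra F K] {q : F} {a b c α β γ : K}

theorem b_mul_c_mul_a (hq : q ≠ 0) (hγc : Commute γ c)
    (hba : b * a = q ^ 2 • (a * b) + (q * (q ^ 2 - q⁻¹ ^ 2)) • c - (q * (q - q⁻¹)) • γ)
    (hac : a * c = q ^ 2 • (c * a) + (q * (q ^ 2 - q⁻¹ ^ 2)) • b - (q * (q - q⁻¹)) • β) :
    b * c * a = a * b * c + (q⁻¹ * (q ^ 2 - q⁻¹ ^ 2)) • (c ^ 2 - b ^ 2)
      - (q⁻¹ * (q - q⁻¹)) • (c * γ - b * β) := by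
  have hbac : b * a * c = q ^ 2 • (a * b * c) + (q * (q ^ 2 - q⁻¹ ^ 2)) • c ^ 2
      - (q * (q - q⁻¹)) • (c * γ) := by
    rw [hba, hγc.symm.eq]
    simp only [add_mul, sub_mul, smul_mul_assoc, sq]
  have hbac' : b * a * c = q ^ 2 • (b * c * a) + (q * (q ^ 2 - q⁻¹ ^ 2)) • b ^ 2
      - (q * (q - q⁻¹)) • (b * β) := by
    rw [mul_assoc, hac]
    simp only [mul_add, mul_sub, mul_smul_comm, mul_assoc, sq]
  refine smul_right_injective K (pow_ne_zero 2 hq) ?_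
  have hcancel := hbac'.symm.trans hbac
  rw [← sub_eq_zero] at hcancel ⊢
  rw [← hcancel]
  match_scalars <;> field_simp

/-- The third relation is compatible with the first two: this makes it enough to check it on a
generating set of an `a`-module. -/
theorem commute_c_mul_b_sub (hq : q ≠ 0) (hαa : Commute α a) (hβb : Commute β b)
    (hγc : Commute γ c)
    (hba : b * a = q ^ 2 • (a * b) + (q * (q ^ 2 - q⁻¹ ^ 2)) • c - (q * (q - q⁻¹)) • γ)
    (hac : a * c = q ^ 2 • (c * a) + (q * (q ^ 2 - q⁻¹ ^ 2)) • b - (q * (q - q⁻¹)) • β) :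
    Commute (c * b - (q ^ 2 • (b * c) + (q * (q ^ 2 - q⁻¹ ^ 2)) • a - (q * (q - q⁻¹)) • α)) a := by
  have hcba : c * b * a = q ^ 2 • (c * a * b) + (q * (q ^ 2 - q⁻¹ ^ 2)) • c ^ 2
      - (q * (q - q⁻¹)) • (c * γ) := by
    rw [mul_assoc, hba]
    simp only [mul_add, mul_sub, mul_smul_comm, mul_assoc, sq]
  have hacb : a * (c * b) = q ^ 2 • (c * a * b) + (q * (q ^ 2 - q⁻¹ ^ 2)) • b ^ 2
      - (q * (q - q⁻¹)) • (b * β) := by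
    rw [← mul_assoc, hac, hβb.symm.eq]
    simp only [add_mul, sub_mul, smul_mul_assoc, sq]
  simp only [commute_iff_eq, add_mul, sub_mul, mul_add, mul_sub, smul_mul_assoc, mul_smul_comm,
    hcba, hacb, b_mul_c_mul_a hq hγc hba hac, hαa.eq, ← mul_assoc]
  match_scalars <;> field_simp <;> ring

end AskeyWilson

namespace IsAskeyWilsonTriple

variable {F K : Type*} [Field F] [Ring K] [Algebra F K] {q : F} {a b c α β γ : K}

theorem rotate (h : IsAskeyWilsonTriple q a b c α β γ) : IsAskeyWilsonTriple q b c a β γ α where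
  comm_α := h.comm_β
  comm_β := h.comm_γ
  comm_γ := h.comm_α
  b_mul_a := h.c_mul_b
  c_mul_b := h.a_mul_c
  a_mul_c := h.b_mul_a

section Casimir

theorem casimir_rotate (h : IsAskeyWilsonTriple q a b c α β γ) (hq : q ≠ 0) :
    askeyWilsonCasimir q b c a β γ α = askeyWilsonCasimir q a b c α β γ := by
  rw [askeyWilsonCasimir, askeyWilsonCasimir,
    AskeyWilson.b_mul_c_mul_a hq (h.comm_γ c) h.b_mul_a h.a_mul_c]
  match_scalars <;> field_simp <;> ring

theorem a_mul_b_sq_sub_b_sq_mul_a (h : IsAskeyWilsonTriple q a b c α β γ) (hq : q ≠ 0) :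
    q ^ 2 • (a * b ^ 2) - q⁻¹ ^ 2 • (b ^ 2 * a) = (q ^ 2 - q⁻¹ ^ 2) •
      (γ * b - q • (c * b) - q⁻¹ • (b * c)) := by
  have h₁ : b * a * b = q ^ 2 • (a * b ^ 2) + (q * (q ^ 2 - q⁻¹ ^ 2)) • (c * b)
      - (q * (q - q⁻¹)) • (γ * b) := by
    rw [h.b_mul_a]
    simp only [add_mul, sub_mul, smul_mul_assoc, sq, mul_assoc]
  have h₂ : b ^ 2 * a = q ^ 2 • (b * a * b) + (q * (q ^ 2 - q⁻¹ ^ 2)) • (b * c)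
      - (q * (q - q⁻¹)) • (γ * b) := by
    rw [sq, mul_assoc, mul_assoc b a b, h.b_mul_a, (h.comm_γ b).eq]
    simp only [mul_add, mul_sub, mul_smul_comm]
  rw [h₂, h₁]
  match_scalars <;> field_simp <;> ring

theorem a_mul_c_sq_sub_c_sq_mul_a (h : IsAskeyWilsonTriple q a b c α β γ) (hq : q ≠ 0) :
    q⁻¹ ^ 2 • (a * c ^ 2) - q ^ 2 • (c ^ 2 * a) = (q ^ 2 - q⁻¹ ^ 2) •
      (q • (c * b) + q⁻¹ • (b * c) - β * c) := by
  have h₁ : a * c ^ 2 = q ^ 2 • (c * a * c) + (q * (q ^ 2 - q⁻¹ ^ 2)) • (b * c)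
      - (q * (q - q⁻¹)) • (β * c) := by
    rw [sq, ← mul_assoc, h.a_mul_c]
    simp only [add_mul, sub_mul, smul_mul_assoc]
  have h₂ : c * a * c = q ^ 2 • (c ^ 2 * a) + (q * (q ^ 2 - q⁻¹ ^ 2)) • (c * b)
      - (q * (q - q⁻¹)) • (β * c) := by
    rw [mul_assoc, h.a_mul_c, (h.comm_β c).eq]
    simp only [mul_add, mul_sub, mul_smul_comm, mul_assoc, sq]
  rw [h₁, h₂]
  match_scalars <;> field_simp <;> ring

/-- Since `a * (b * c * a) = (a * b * c) * a`, the cubic terms cancel when the two sides are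
expanded with the rotated and the original form of the Casimir expression. -/
theorem commute_casimir_a (h : IsAskeyWilsonTriple q a b c α β γ) (hq : q ≠ 0) :
    Commute (askeyWilsonCasimir q a b c α β γ) a := by
  have hβ : q • (a * b * β) - q⁻¹ • (b * a * β) =
      (q - q⁻¹) • (β * γ) - (q ^ 2 - q⁻¹ ^ 2) • (β * c) := by
    rw [(h.comm_β _).symm.eq, (h.comm_β _).symm.eq, h.b_mul_a]
    simp only [mul_add, mul_sub, mul_smul_comm]
    match_scalars <;> field_simp
    ring
  have hγ : q⁻¹ • (a * c * γ) - q • (c * a * γ) =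
      (q ^ 2 - q⁻¹ ^ 2) • (γ * b) - (q - q⁻¹) • (β * γ) := by
    rw [(h.comm_γ _).symm.eq, (h.comm_γ _).symm.eq, h.a_mul_c, (h.comm_β _).eq]
    simp only [mul_add, mul_sub, mul_smul_comm]
    match_scalars <;> field_simp
    ring
  have hleft : askeyWilsonCasimir q a b c α β γ * a = (q ^ 2 + q⁻¹ ^ 2) • a - q • (a * (b * c * a))
      - q ^ 2 • a ^ 3 - q⁻¹ ^ 2 • (b ^ 2 * a) - q ^ 2 • (c ^ 2 * a)
      + q • (a ^ 2 * α) + q⁻¹ • (b * a * β) + q • (c * a * γ) := by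
    simp only [askeyWilsonCasimir, Algebra.algebraMap_eq_smul_one, add_mul, sub_mul,
      smul_mul_assoc, one_mul, mul_assoc, (h.comm_α a).eq, (h.comm_β a).eq, (h.comm_γ a).eq,
      pow_succ, pow_zero]
  have hright : a * askeyWilsonCasimir q b c a β γ α = (q ^ 2 + q⁻¹ ^ 2) • a
      - q • (a * (b * c * a)) - q ^ 2 • (a * b ^ 2) - q⁻¹ ^ 2 • (a * c ^ 2) - q ^ 2 • a ^ 3
      + q • (a * b * β) + q⁻¹ • (a * c * γ) + q • (a ^ 2 * α) := by
    simp only [askeyWilsonCasimir, Algebra.algebraMap_eq_smul_one, mul_add, mul_sub,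
      mul_smul_comm, mul_one, one_mul, mul_assoc, pow_succ, pow_zero]
  have heq : askeyWilsonCasimir q a b c α β γ * a = a * askeyWilsonCasimir q b c a β γ α := by
    rw [hleft, hright]
    linear_combination (norm := module) h.a_mul_b_sq_sub_b_sq_mul_a hq
      + h.a_mul_c_sq_sub_c_sq_mul_a hq - hβ - hγ
  rwa [h.casimir_rotate hq] at heq

theorem commute_casimir_b (h : IsAskeyWilsonTriple q a b c α β γ) (hq : q ≠ 0) :
    Commute (askeyWilsonCasimir q a b c α β γ) b := by
  rw [← h.casimir_rotate hq]
  exact h.rotate.commute_casimir_a hq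

theorem commute_casimir_c (h : IsAskeyWilsonTriple q a b c α β γ) (hq : q ≠ 0) :
    Commute (askeyWilsonCasimir q a b c α β γ) c := by
  rw [← h.casimir_rotate hq]
  exact h.rotate.commute_casimir_b hq

end Casimir

end IsAskeyWilsonTriple

namespace AskeyWilson

open Polynomial

section Chebyshev

variable {F : Type*} [Field F] {q : F} {n : ℕ}

theorem aeval_chebyshevC_add {R : Type*} [CommRing R] [Algebra F R] {u v : R} (huv : u * v = 1)
    (n : ℕ) : aeval (u + v) (Chebyshev.C F n) = u ^ n + v ^ n := by
  rw [Chebyshev.aeval_C, ← dickson_one_one_eq_chebyshev_C, dickson_one_one_eval_add_inv u v huv]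

/-- Parametrising the conic as `x = u + v`, `y = q² u + q⁻² v` with `u v = 1` turns the two sides
into `uⁿ + vⁿ` and `q²ⁿ uⁿ + q⁻²ⁿ vⁿ`. -/
theorem aeval_chebyshevC_eq_of_conic {R : Type*} [CommRing R] [Algebra F R] {x y : R}
    (hq : q ^ 2 - q⁻¹ ^ 2 ≠ 0) (hn : (q ^ 2) ^ n = 1)
    (hxy : y ^ 2 - algebraMap F R (q ^ 2 + q⁻¹ ^ 2) * (x * y) + x ^ 2
      + algebraMap F R ((q ^ 2 - q⁻¹ ^ 2) ^ 2) = 0) :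
    aeval y (Chebyshev.C F n) = aeval x (Chebyshev.C F n) := by
  have hq₀ : q ≠ 0 := by rintro rfl; simp at hq
  set κ := q ^ 2 - q⁻¹ ^ 2 with hκ
  set u := κ⁻¹ • (y - q⁻¹ ^ 2 • x) with hu
  set v := κ⁻¹ • (q ^ 2 • x - y) with hv
  have hx : u + v = x := by
    rw [hu, hv, ← smul_add, inv_smul_eq_iff₀ hq, hκ]
    module
  have hy : q ^ 2 • u + q⁻¹ ^ 2 • v = y := by
    rw [hu, hv, smul_comm _ κ⁻¹, smul_comm _ κ⁻¹, ← smul_add, inv_smul_eq_iff₀ hq, hκ]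
    match_scalars <;> field_simp <;> ring
  have huv : u * v = 1 := by
    rw [hu, hv, smul_mul_smul_comm, ← mul_inv, ← sq, inv_smul_eq_iff₀ (pow_ne_zero 2 hq),
      ← Algebra.algebraMap_eq_smul_one]
    have hq₁ : algebraMap F R (q ^ 2) * algebraMap F R (q⁻¹ ^ 2) = 1 := by
      rw [← map_mul, ← mul_pow, mul_inv_cancel₀ hq₀, one_pow, map_one]
    rw [map_add] at hxy
    simp only [Algebra.smul_def]
    linear_combination -hxy - x ^ 2 * hq₁
  have hn' : (q⁻¹ ^ 2) ^ n = 1 := by rw [inv_pow, inv_pow, hn, inv_one]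
  have huv' : (q ^ 2 • u) * (q⁻¹ ^ 2 • v) = 1 := by
    rw [smul_mul_smul_comm, huv, ← mul_pow, mul_inv_cancel₀ hq₀, one_pow, one_smul]
  rw [← hx, aeval_chebyshevC_add huv, ← hy, aeval_chebyshevC_add huv', _root_.smul_pow _ u,
    _root_.smul_pow _ v, hn, hn', one_smul, one_smul]

/-- The polynomial `Y² - (q² + q⁻²) X Y + X² + (q² - q⁻²)²`, which governs the relation between
left and right multiplication by `A`. -/
noncomputable def conic (q : F) : F[X][X] :=
  X ^ 2 - algebraMap F F[X][X] (q ^ 2 + q⁻¹ ^ 2) * (C X * X) + C X ^ 2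
    + algebraMap F F[X][X] ((q ^ 2 - q⁻¹ ^ 2) ^ 2)

theorem map_conic {R : Type*} [Ring R] [Algebra F R] (φ : F[X][X] →ₐ[F] R) :
    φ (conic q) = φ X ^ 2 - algebraMap F R (q ^ 2 + q⁻¹ ^ 2) * (φ (C X) * φ X) + φ (C X) ^ 2
      + algebraMap F R ((q ^ 2 - q⁻¹ ^ 2) ^ 2) := by
  simp only [conic, map_add φ, map_sub φ, map_mul φ, map_pow φ, AlgHom.commutes]

theorem map_chebyshevC_eq_of_map_conic_eq_zero {R : Type*} [CommRing R] [Algebra F R]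
    (hq : q ^ 2 - q⁻¹ ^ 2 ≠ 0) (hn : (q ^ 2) ^ n = 1) (φ : F[X][X] →ₐ[F] R)
    (hφ : φ (conic q) = 0) :
    φ ((Chebyshev.C F n).map (algebraMap F F[X])) = φ (C (Chebyshev.C F n)) := by
  have hC : C (Chebyshev.C F n) = aeval (C X : F[X][X]) (Chebyshev.C F n) := by
    rw [← CAlgHom_apply (R := F), ← CAlgHom_apply (R := F), aeval_algHom_apply, aeval_X_left_apply]
  rw [← aeval_X_left_eq_map, hC, ← aeval_algHom_apply, ← aeval_algHom_apply]
  exact aeval_chebyshevC_eq_of_conic hq hn ((map_conic φ).symm.trans hφ)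

theorem conic_dvd_map_chebyshevC_sub (hq : q ^ 2 - q⁻¹ ^ 2 ≠ 0) (hn : (q ^ 2) ^ n = 1) :
    conic q ∣ (Chebyshev.C F n).map (algebraMap F F[X]) - C (Chebyshev.C F n) := by
  have h := map_chebyshevC_eq_of_map_conic_eq_zero (R := F[X][X] ⧸ Ideal.span {conic q}) hq hn
    (Ideal.Quotient.mkₐ F (Ideal.span {conic q}))
    (Ideal.Quotient.eq_zero_iff_mem.2 (Ideal.mem_span_singleton_self (conic q)))
  rw [← Ideal.mem_span_singleton, ← Ideal.Quotient.eq]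
  exact h

theorem eval_X_conic_ne_zero (hq : q ^ 2 - q⁻¹ ^ 2 ≠ 0) : (conic q).eval X ≠ 0 := by
  intro h
  have h₀ := congrArg (eval 0) h
  simp only [conic, Polynomial.algebraMap_apply, eval_add, eval_sub, eval_mul,
    eval_pow, eval_X, eval_C, eval_zero] at h₀
  exact pow_ne_zero 2 hq (by simpa using h₀)

theorem sub_mul_conic_dvd_map_chebyshevC_sub (hq : q ^ 2 - q⁻¹ ^ 2 ≠ 0)
    (hn : (q ^ 2) ^ n = 1) :
    (X - C X) * conic q ∣
      (Chebyshev.C F n).map (algebraMap F F[X]) - C (Chebyshev.C F n) := by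
  obtain ⟨p, hp⟩ := conic_dvd_map_chebyshevC_sub hq hn
  have hroot : p.IsRoot X := by
    have h := congrArg (eval X) hp
    rw [eval_sub, eval_map_algebraMap, aeval_X_left_apply, eval_C, sub_self, eval_mul] at h
    exact (mul_eq_zero.1 h.symm).resolve_left (eval_X_conic_ne_zero hq)
  obtain ⟨r, rfl⟩ := dvd_iff_isRoot.2 hroot
  exact ⟨r, by rw [hp, mul_left_comm, mul_assoc]⟩

variable {K : Type*} [Ring K] [Algebra F K]

theorem aeval_mulLeft_apply (a b : K) (p : F[X]) :
    aeval (LinearMap.mulLeft F a) p b = aeval a p * b := by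
  simp only [aeval_eq_sum_range, LinearMap.pow_mulLeft, LinearMap.sum_apply, LinearMap.smul_apply,
    LinearMap.mulLeft_apply, Finset.sum_mul, smul_mul_assoc]

theorem aeval_mulRight_apply (a b : K) (p : F[X]) :
    aeval (LinearMap.mulRight F a) p b = b * aeval a p := by
  simp only [aeval_eq_sum_range, LinearMap.pow_mulRight, LinearMap.sum_apply, LinearMap.smul_apply,
    LinearMap.mulRight_apply, Finset.mul_sum, mul_smul_comm]

/-- Substituting left multiplication by `a` for `X` and right multiplication by `a` for `Y` turns
divisibility in `F[X][Y]` into an identity between commutators with `a`. -/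
theorem commute_aeval_chebyshevC {a b : K} (hq : q ^ 2 - q⁻¹ ^ 2 ≠ 0) (hn : (q ^ 2) ^ n = 1)
    (hab : Commute a (b * a ^ 2 - (q ^ 2 + q⁻¹ ^ 2) • (a * b * a) + a ^ 2 * b
      + (q ^ 2 - q⁻¹ ^ 2) ^ 2 • b)) :
    Commute (aeval a (Chebyshev.C F n)) b := by
  have hcomm (p : F[X]) : Commute (aeval (LinearMap.mulLeft F a) p) (LinearMap.mulRight F a) :=
    LinearMap.ext fun x => by simp only [Module.End.mul_apply, aeval_mulLeft_apply,
      LinearMap.mulRight_apply, mul_assoc]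
  let Φ : F[X][X] →ₐ[F] Module.End F K :=
    eval₂AlgHom (aeval (LinearMap.mulLeft F a)) (LinearMap.mulRight F a) hcomm
  have hX : Φ X = LinearMap.mulRight F a := eval₂_X _ _
  have hC (p : F[X]) : Φ (C p) = aeval (LinearMap.mulLeft F a) p := eval₂_C _ _
  have hmap (p : F[X]) : Φ (p.map (algebraMap F F[X])) = aeval (LinearMap.mulRight F a) p := by
    rw [← hX, aeval_algHom_apply, aeval_X_left_eq_map]
  have hconic : Φ (conic q) b = b * a ^ 2 - (q ^ 2 + q⁻¹ ^ 2) • (a * b * a) + a ^ 2 * b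
      + (q ^ 2 - q⁻¹ ^ 2) ^ 2 • b := by
    simp only [map_conic, hX, hC, aeval_X,
      LinearMap.add_apply, LinearMap.sub_apply, Module.End.mul_apply, LinearMap.pow_mulLeft,
      LinearMap.pow_mulRight, LinearMap.mulLeft_apply, LinearMap.mulRight_apply,
      Module.algebraMap_end_apply, mul_assoc]
  obtain ⟨r, hr⟩ := sub_mul_conic_dvd_map_chebyshevC_sub hq hn
  have h := congrArg (Φ · b) hr
  simp only [mul_comm _ r, map_sub Φ, map_mul Φ, hmap, hC, hX, aeval_X, LinearMap.sub_apply,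
    Module.End.mul_apply, hconic, LinearMap.mulLeft_apply, LinearMap.mulRight_apply,
    aeval_mulLeft_apply, aeval_mulRight_apply, hab.eq, sub_self, map_zero] at h
  exact (sub_eq_zero.1 h).symm

end Chebyshev

end AskeyWilson

namespace IsAskeyWilsonTriple

section Chebyshev

open Polynomial

variable {F K : Type*} [Field F] [Ring K] [Algebra F K] {q : F} {a b c α β γ : K} {n : ℕ}

theorem reflect (h : IsAskeyWilsonTriple q a b c α β γ) (hq : q ≠ 0) :
    IsAskeyWilsonTriple q⁻¹ b a c β α γ where
  comm_α := h.comm_β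
  comm_β := h.comm_α
  comm_γ := h.comm_γ
  b_mul_a := by
    rw [h.b_mul_a]
    match_scalars <;> field_simp <;> ring
  c_mul_b := by
    rw [h.a_mul_c]
    match_scalars <;> field_simp <;> ring
  a_mul_c := by
    rw [h.c_mul_b]
    match_scalars <;> field_simp <;> ring

theorem conic_apply (h : IsAskeyWilsonTriple q a b c α β γ) (hq : q ≠ 0) :
    b * a ^ 2 - (q ^ 2 + q⁻¹ ^ 2) • (a * b * a) + a ^ 2 * b + (q ^ 2 - q⁻¹ ^ 2) ^ 2 • b =
      ((q ^ 2 - q⁻¹ ^ 2) * (q - q⁻¹)) • β - (q - q⁻¹) ^ 2 • (γ * a) := by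
  have hc : (q * (q ^ 2 - q⁻¹ ^ 2)) • c = b * a - q ^ 2 • (a * b) + (q * (q - q⁻¹)) • γ := by
    rw [h.b_mul_a]
    module
  have hac := congrArg ((q * (q ^ 2 - q⁻¹ ^ 2)) • ·) h.a_mul_c
  simp only [smul_sub, smul_add, smul_comm _ (q ^ 2) (c * a)] at hac
  rw [← mul_smul_comm, ← smul_mul_assoc, hc] at hac
  simp only [mul_add, mul_sub, add_mul, sub_mul, mul_smul_comm, smul_mul_assoc,
    (h.comm_γ a).symm.eq, ← mul_assoc, ← sq] at hac
  simp only [mul_assoc, ← sq] at hac ⊢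
  refine smul_right_injective K (pow_ne_zero 2 hq) ?_
  linear_combination (norm := (match_scalars <;> field_simp <;> ring)) -hac

theorem commute_aeval_chebyshevC_b (h : IsAskeyWilsonTriple q a b c α β γ) (hq : q ≠ 0)
    (hn : IsPrimitiveRoot (q ^ 2) n) : Commute (aeval a (Chebyshev.C F n)) b := by
  by_cases hκ : q ^ 2 - q⁻¹ ^ 2 = 0
  · have hq₄ : (q ^ 2) ^ 2 = 1 := by
      field_simp at hκ
      linear_combination hκ
    rcases (Nat.dvd_prime Nat.prime_two).1 (hn.dvd_of_pow_eq_one 2 hq₄) with rfl | rfl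
    · have hba := h.b_mul_a
      have hq₂ : q ^ 2 = 1 := IsPrimitiveRoot.one_right_iff.1 hn
      have hμ : q * (q - q⁻¹) = 0 := by
        field_simp
        rw [hq₂, sub_self]
      rw [hκ, hμ, hq₂, mul_zero, zero_smul, zero_smul, one_smul, add_zero, sub_zero] at hba
      rw [Nat.cast_one, Chebyshev.C_one, aeval_X]
      exact hba.symm
    · have hba := h.b_mul_a
      rw [hκ, hn.eq_neg_one_of_two_right, mul_zero, zero_smul, neg_one_smul, add_zero] at hba
      have hba₂ : b * a ^ 2 = a ^ 2 * b := by
        rw [sq, ← mul_assoc, hba, sub_mul, neg_mul, mul_assoc, hba, smul_mul_assoc,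
          (h.comm_γ a).eq, mul_sub, mul_neg, mul_smul_comm, mul_assoc]
        abel
      rw [Nat.cast_two, Chebyshev.C_two, map_sub, map_pow, aeval_X, map_ofNat]
      exact Commute.sub_left hba₂.symm (Commute.ofNat_left 2 b)
  · refine AskeyWilson.commute_aeval_chebyshevC hκ hn.pow_eq_one ?_
    rw [h.conic_apply hq]
    exact ((h.comm_β a).symm.smul_right _).sub_right
      (((h.comm_γ a).symm.mul_right (Commute.refl a)).smul_right _)

theorem commute_aeval_chebyshevC_c (h : IsAskeyWilsonTriple q a b c α β γ) (hq : q ≠ 0)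
    (hn : IsPrimitiveRoot (q ^ 2) n) : Commute (aeval a (Chebyshev.C F n)) c :=
  (h.reflect hq).rotate.commute_aeval_chebyshevC_b (inv_ne_zero hq) (inv_pow q 2 ▸ hn.inv)

end Chebyshev

end IsAskeyWilsonTriple

namespace UAW

section Relations

variable (F : Type*) [Field F] (q : F)

variable {F q} in
theorem mk_eq_mk_of_rel {x y : FreeAlgebra F UAWGen} (h : UAWRel F q x y) :
    mk F q x = mk F q y :=
  RingQuot.mkAlgHom_rel F h

theorem adjoin_range_gen : Algebra.adjoin F (Set.range (gen F q)) = ⊤ := by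
  have h : Set.range (gen F q) = mk F q '' Set.range (FreeAlgebra.ι F) := by
    rw [← Set.range_comp]; rfl
  rw [h, ← AlgHom.map_adjoin, FreeAlgebra.adjoin_range_ι, Algebra.map_top]
  exact (AlgHom.range_eq_top _).2 (RingQuot.mkAlgHom_surjective F (UAWRel F q))

variable {F q}

theorem mem_center_of_commute_gen {z : UAW F q} (h : ∀ g, Commute z (gen F q g)) :
    z ∈ Subalgebra.center F (UAW F q) := by
  have hle : Algebra.adjoin F (Set.range (gen F q)) ≤ Subalgebra.centralizer F {z} := by
    rw [Algebra.adjoin_le_iff]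
    rintro _ ⟨g, rfl⟩
    rw [SetLike.mem_coe, Subalgebra.mem_centralizer_iff]
    rintro _ rfl
    exact h g
  rw [adjoin_range_gen, top_le_iff] at hle
  rw [Subalgebra.mem_center_iff]
  intro b
  have hb : b ∈ Subalgebra.centralizer F {z} := hle ▸ Algebra.mem_top
  exact ((Subalgebra.mem_centralizer_iff F).1 hb z rfl).symm

variable (F q)

theorem α_mem_center : α F q ∈ Subalgebra.center F (UAW F q) :=
  mem_center_of_commute_gen fun g => by
    simpa only [commute_iff_eq, α, gen, map_mul] using mk_eq_mk_of_rel (.α_central (q := q) g)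

theorem β_mem_center : β F q ∈ Subalgebra.center F (UAW F q) :=
  mem_center_of_commute_gen fun g => by
    simpa only [commute_iff_eq, β, gen, map_mul] using mk_eq_mk_of_rel (.β_central (q := q) g)

theorem γ_mem_center : γ F q ∈ Subalgebra.center F (UAW F q) :=
  mem_center_of_commute_gen fun g => by
    simpa only [commute_iff_eq, γ, gen, map_mul] using mk_eq_mk_of_rel (.γ_central (q := q) g)

variable {F q}

theorem isAskeyWilsonTriple (hq : q ≠ 0) :
    IsAskeyWilsonTriple q (A F q) (B F q) (C F q) (α F q) (β F q) (γ F q) where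
  comm_α x := (Subalgebra.mem_center_iff.1 (α_mem_center F q) x).symm
  comm_β x := (Subalgebra.mem_center_iff.1 (β_mem_center F q) x).symm
  comm_γ x := (Subalgebra.mem_center_iff.1 (γ_mem_center F q) x).symm
  b_mul_a := by
    simpa only [A, B, C, γ, gen, map_mul, map_add, map_sub, map_smul] using
      mk_eq_mk_of_rel (.BA (q := q))
  c_mul_b := by
    simpa only [A, B, C, α, gen, map_mul, map_add, map_sub, map_smul] using
      mk_eq_mk_of_rel (.CB (q := q))
  a_mul_c := by
    have hCA : C F q * A F q = q⁻¹ ^ 2 • (A F q * C F q)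
        - (q⁻¹ * (q ^ 2 - q⁻¹ ^ 2)) • B F q + (q⁻¹ * (q - q⁻¹)) • β F q := by
      simpa only [A, B, C, β, gen, map_mul, map_add, map_sub, map_smul] using
        mk_eq_mk_of_rel (.CA (q := q))
    rw [hCA]
    match_scalars <;> field_simp <;> ring

theorem mem_center_of_commute {z : UAW F q} (hA : Commute z (A F q)) (hB : Commute z (B F q))
    (hC : Commute z (C F q)) : z ∈ Subalgebra.center F (UAW F q) := by
  refine mem_center_of_commute_gen fun g => ?_
  cases g with
  | A => exact hA
  | B => exact hB
  | C => exact hC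
  | α => exact Subalgebra.mem_center_iff.1 (α_mem_center F q) z
  | β => exact Subalgebra.mem_center_iff.1 (β_mem_center F q) z
  | γ => exact Subalgebra.mem_center_iff.1 (γ_mem_center F q) z

theorem Ω_mem_center (hq : q ≠ 0) : Ω F q ∈ Subalgebra.center F (UAW F q) :=
  have h := isAskeyWilsonTriple hq
  mem_center_of_commute (h.commute_casimir_a hq) (h.commute_casimir_b hq) (h.commute_casimir_c hq)

end Relations

section Lift

variable {F K : Type*} [Field F] [Ring K] [Algebra F K] {q : F} {a b c α β γ : K}

/-- The images of the generators of the universal Askey--Wilson algebra under the homomorphism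
`UAW.lift` attached to an Askey--Wilson triple. -/
def liftGen (a b c α β γ : K) : UAWGen → K
  | .A => a
  | .B => b
  | .C => c
  | .α => α
  | .β => β
  | .γ => γ

/-- The homomorphism from the universal Askey--Wilson algebra attached to a triple satisfying its
relations. -/
noncomputable def lift (hq : q ≠ 0) (h : IsAskeyWilsonTriple q a b c α β γ) : UAW F q →ₐ[F] K :=
  RingQuot.liftAlgHom F ⟨FreeAlgebra.lift F (liftGen a b c α β γ), fun x y hxy => by
    induction hxy with
    | α_central g => simpa only [map_mul, FreeAlgebra.lift_ι_apply, liftGen] using (h.comm_α _).eq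
    | β_central g => simpa only [map_mul, FreeAlgebra.lift_ι_apply, liftGen] using (h.comm_β _).eq
    | γ_central g => simpa only [map_mul, FreeAlgebra.lift_ι_apply, liftGen] using (h.comm_γ _).eq
    | CB =>
      simpa only [map_mul, map_add, map_sub, map_smul, FreeAlgebra.lift_ι_apply, liftGen]
        using h.c_mul_b
    | BA =>
      simpa only [map_mul, map_add, map_sub, map_smul, FreeAlgebra.lift_ι_apply, liftGen]
        using h.b_mul_a
    | CA =>
      simp only [map_mul, map_add, map_sub, map_smul, FreeAlgebra.lift_ι_apply, liftGen,
        h.a_mul_c]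
      match_scalars <;> field_simp <;> ring⟩

theorem lift_gen (hq : q ≠ 0) (h : IsAskeyWilsonTriple q a b c α β γ) (g : UAWGen) :
    lift hq h (gen F q g) = liftGen a b c α β γ g :=
  (RingQuot.liftAlgHom_mkAlgHom_apply F _ _ _).trans (FreeAlgebra.lift_ι_apply _ _)

end Lift

section RootOfUnity

variable {F : Type*} [Field F] {q : F} {d n : ℕ}

theorem dbar_pos (hd : 0 < d) : 0 < dbar d := by
  rw [dbar]
  split_ifs with h
  · obtain ⟨e, rfl⟩ := h
    omega
  · exact hd

theorem isPrimitiveRoot_sq_dbar (hd : 0 < d) (hq : IsPrimitiveRoot q d) :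
    IsPrimitiveRoot (q ^ 2) (dbar d) := by
  rw [dbar]
  split_ifs with h
  · exact hq.pow hd (Nat.mul_div_cancel' h.two_dvd).symm
  · exact hq.pow_of_coprime 2 (Nat.coprime_two_left.2 (Nat.not_even_iff_odd.1 h))

theorem commute_T_self (x : UAW F q) : Commute (T F q n x) x := by
  simpa only [T, Polynomial.aeval_X] using
    (Commute.all (Polynomial.Chebyshev.C F (n : ℤ)) Polynomial.X).map (Polynomial.aeval x)

theorem T_A_mem_center (hq : q ≠ 0) (hn : IsPrimitiveRoot (q ^ 2) n) :
    T F q n (A F q) ∈ Subalgebra.center F (UAW F q) :=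
  have h := isAskeyWilsonTriple hq
  mem_center_of_commute (commute_T_self _) (h.commute_aeval_chebyshevC_b hq hn)
    (h.commute_aeval_chebyshevC_c hq hn)

theorem T_B_mem_center (hq : q ≠ 0) (hn : IsPrimitiveRoot (q ^ 2) n) :
    T F q n (B F q) ∈ Subalgebra.center F (UAW F q) :=
  have h := (isAskeyWilsonTriple hq).rotate
  mem_center_of_commute (h.commute_aeval_chebyshevC_c hq hn) (commute_T_self _)
    (h.commute_aeval_chebyshevC_b hq hn)

theorem T_C_mem_center (hq : q ≠ 0) (hn : IsPrimitiveRoot (q ^ 2) n) :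
    T F q n (C F q) ∈ Subalgebra.center F (UAW F q) :=
  have h := (isAskeyWilsonTriple hq).rotate.rotate
  mem_center_of_commute (h.commute_aeval_chebyshevC_b hq hn)
    (h.commute_aeval_chebyshevC_c hq hn) (commute_T_self _)

end RootOfUnity

end UAW

namespace AskeyWilson

open Polynomial

section Intertwiner

variable {S N : Type*} [CommRing S] [AddCommGroup N] [Module S N]

/-- The linear map from `S[X][X]` which sends the `j`-th power of the outer variable to `v j` and
turns multiplication by the inner variable into `m`. -/
noncomputable def intertwiner (m : Module.End S N) (v : ℕ → N) : S[X][X] →ₗ[S] N :=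
  lsum fun j => LinearMap.applyₗ (v j) ∘ₗ (aeval m).toLinearMap

variable (m : Module.End S N) (v : ℕ → N)

theorem intertwiner_apply (x : S[X][X]) :
    intertwiner m v x = x.sum fun j p => aeval m p (v j) := rfl

theorem intertwiner_smul_X_pow (p : S[X]) (j : ℕ) :
    intertwiner m v (p • X ^ j) = aeval m p (v j) := by
  rw [intertwiner_apply, smul_X_eq_monomial, sum_monomial_index _ _ (by simp)]

theorem intertwiner_X_pow (j : ℕ) : intertwiner m v (X ^ j) = v j := by
  simpa using intertwiner_smul_X_pow m v 1 j

theorem intertwiner_X_smul (x : S[X][X]) :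
    intertwiner m v ((X : S[X]) • x) = m (intertwiner m v x) := by
  induction x using Polynomial.induction_on' with
  | add x y hx hy => rw [smul_add, map_add, hx, hy, map_add, map_add]
  | monomial j p =>
    rw [← smul_X_eq_monomial, smul_smul, intertwiner_smul_X_pow, intertwiner_smul_X_pow, map_mul,
      aeval_X, Module.End.mul_apply]

variable {m v}

theorem intertwiner_congr {v' : ℕ → N} {k : ℕ} (h : ∀ j < k, v j = v' j) {x : S[X][X]}
    (hx : x ∈ degreeLT S[X] k) : intertwiner m v x = intertwiner m v' x := by
  rw [intertwiner_apply, intertwiner_apply]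
  exact Finset.sum_congr rfl fun j hj => congrArg _
    (h j (Nat.cast_lt.1 ((le_degree_of_mem_supp j hj).trans_lt (mem_degreeLT.1 hx))))

theorem intertwiner_mem {P : Submodule S N} (hm : Set.MapsTo m P P) {k : ℕ}
    (hv : ∀ j < k, v j ∈ P) {x : S[X][X]} (hx : x ∈ degreeLT S[X] k) :
    intertwiner m v x ∈ P := by
  have haeval (p : S[X]) {y : N} (hy : y ∈ P) : aeval m p y ∈ P := by
    induction p using Polynomial.induction_on' with
    | add p r hp hr => simpa only [map_add, LinearMap.add_apply] using add_mem hp hr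
    | monomial i s =>
      rw [aeval_monomial, ← Algebra.smul_def, LinearMap.smul_apply, Module.End.pow_apply]
      exact P.smul_mem s (Set.MapsTo.iterate hm i hy)
  rw [intertwiner_apply]
  exact sum_mem fun j hj => haeval _
    (hv j (Nat.cast_lt.1 ((le_degree_of_mem_supp j hj).trans_lt (mem_degreeLT.1 hx))))

theorem eq_of_map_X_smul_of_map_X_pow {f g : S[X][X] →ₗ[S] N}
    (hf : ∀ x, f ((X : S[X]) • x) = m (f x)) (hg : ∀ x, g ((X : S[X]) • x) = m (g x))
    (h : ∀ j, f (X ^ j) = g (X ^ j)) : f = g := by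
  ext x
  induction x using Polynomial.induction_on' with
  | add x y hx hy => rw [map_add, map_add, hx, hy]
  | monomial j p =>
    rw [← smul_X_eq_monomial]
    induction p using Polynomial.induction_on with
    | C s => rw [← algebraMap_eq, algebraMap_smul, map_smul, map_smul, h]
    | add p r hp hr => rw [add_smul, map_add, map_add, hp, hr]
    | monomial n s ih => rw [pow_succ', mul_left_comm, mul_smul, hf, hg, ih]

end Intertwiner

section Representation

variable {F S : Type*} [Field F] [CommRing S] [Algebra F S] (q : F) (α β γ c : S)

/-- The rule by which `B`, `C` and `1`, collected in a triple, move past `A`. -/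
noncomputable def commutationMap : Module.End S (S[X][X] × S[X][X] × S[X][X]) where
  toFun v :=
    (q ^ 2 • (X : S[X]) • v.1 + (q * (q ^ 2 - q⁻¹ ^ 2)) • v.2.1 - (q * (q - q⁻¹)) • γ • v.2.2,
      q⁻¹ ^ 2 • (X : S[X]) • v.2.1 - (q⁻¹ * (q ^ 2 - q⁻¹ ^ 2)) • v.1
        + (q⁻¹ * (q - q⁻¹)) • β • v.2.2,
      (X : S[X]) • v.2.2)
  map_add' v w := by
    ext1
    · simp only [Prod.fst_add, Prod.snd_add]
      module
    · ext1 <;> simp only [Prod.fst_add, Prod.snd_add] <;> module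
  map_smul' s v := by
    ext1
    · simp only [Prod.smul_fst, Prod.smul_snd, RingHom.id_apply]
      module
    · ext1 <;> simp only [Prod.smul_fst, Prod.smul_snd, RingHom.id_apply] <;> module

/-- The operators of `B`, `C` and `1` on `S[A][B]`, collected in a triple, where `e j` is the
prescribed value of `C` at `B ^ j`. -/
noncomputable def operators (e : ℕ → S[X][X]) : S[X][X] →ₗ[S] S[X][X] × S[X][X] × S[X][X] :=
  intertwiner (commutationMap q β γ) fun j => (X ^ (j + 1), e j, X ^ j)

/-- The operator of `B` on `S[A][B]`, when `C` has the value `e j` at `B ^ j`. -/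
noncomputable def operatorB (e : ℕ → S[X][X]) : Module.End S S[X][X] :=
  LinearMap.fst S _ _ ∘ₗ operators q β γ e

/-- The operator of `C` on `S[A][B]`, when `C` has the value `e j` at `B ^ j`. -/
noncomputable def operatorC (e : ℕ → S[X][X]) : Module.End S S[X][X] :=
  LinearMap.fst S _ _ ∘ₗ LinearMap.snd S _ _ ∘ₗ operators q β γ e

section Operators

variable (e : ℕ → S[X][X])

theorem operators_X_smul (x : S[X][X]) :
    operators q β γ e ((X : S[X]) • x) = commutationMap q β γ (operators q β γ e x) :=
  intertwiner_X_smul _ _ x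

theorem operators_X_pow (j : ℕ) : operators q β γ e (X ^ j) = (X ^ (j + 1), e j, X ^ j) :=
  intertwiner_X_pow _ _ j

theorem operators_snd_snd (x : S[X][X]) : (operators q β γ e x).2.2 = x := by
  have h := eq_of_map_X_smul_of_map_X_pow
    (f := LinearMap.snd S _ _ ∘ₗ LinearMap.snd S _ _ ∘ₗ operators q β γ e) (g := LinearMap.id)
    (m := Algebra.lsmul S S S[X][X] (X : S[X]))
    (fun x => congrArg (Prod.snd ∘ Prod.snd) (operators_X_smul q β γ e x)) (fun x => rfl)
    fun j => congrArg (Prod.snd ∘ Prod.snd) (operators_X_pow q β γ e j)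
  exact LinearMap.congr_fun h x

theorem operatorB_X_smul (x : S[X][X]) :
    operatorB q β γ e ((X : S[X]) • x) = q ^ 2 • (X : S[X]) • operatorB q β γ e x
      + (q * (q ^ 2 - q⁻¹ ^ 2)) • operatorC q β γ e x - (q * (q - q⁻¹)) • γ • x := by
  refine (congrArg Prod.fst (operators_X_smul q β γ e x)).trans ?_
  simp only [commutationMap, LinearMap.coe_mk, AddHom.coe_mk, operators_snd_snd]
  rfl

theorem operatorC_X_smul (x : S[X][X]) :
    operatorC q β γ e ((X : S[X]) • x) = q⁻¹ ^ 2 • (X : S[X]) • operatorC q β γ e x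
      - (q⁻¹ * (q ^ 2 - q⁻¹ ^ 2)) • operatorB q β γ e x + (q⁻¹ * (q - q⁻¹)) • β • x := by
  refine (congrArg (Prod.fst ∘ Prod.snd) (operators_X_smul q β γ e x)).trans ?_
  simp only [commutationMap, LinearMap.coe_mk, AddHom.coe_mk, operators_snd_snd, Function.comp_def]
  rfl

theorem operatorB_X_pow (j : ℕ) : operatorB q β γ e (X ^ j) = X ^ (j + 1) :=
  congrArg Prod.fst (operators_X_pow q β γ e j)

theorem operatorC_X_pow (j : ℕ) : operatorC q β γ e (X ^ j) = e j :=
  congrArg (Prod.fst ∘ Prod.snd) (operators_X_pow q β γ e j)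

theorem operatorB_pow_one (j : ℕ) : (operatorB q β γ e ^ j) 1 = X ^ j := by
  induction j with
  | zero => rfl
  | succ j ih => rw [pow_succ', Module.End.mul_apply, ih, operatorB_X_pow]

end Operators

/-- The value of `C` at `B ^ j`, determined recursively by `C * B = q ^ 2 • (B * C) + ⋯`. Since
this value has degree at most `j` in `B`, only its predecessors are needed to apply `B` to it. -/
noncomputable def valueC : ℕ → S[X][X]
  | 0 => C (C c)
  | j + 1 => q ^ 2 • operatorB q β γ (fun i => if _ : i ≤ j then valueC i else 0) (valueC j)
      + (q * (q ^ 2 - q⁻¹ ^ 2)) • (X : S[X]) • X ^ j - (q * (q - q⁻¹)) • α • X ^ j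

theorem operatorC_pow_one (k : ℕ) : (operatorC q β γ (valueC q α β γ c) ^ k) 1 = c ^ k • 1 := by
  have h₁ : operatorC q β γ (valueC q α β γ c) 1 = c • 1 := by
    rw [← pow_zero X, operatorC_X_pow, valueC, pow_zero]
    exact Algebra.algebraMap_eq_smul_one c
  induction k with
  | zero => rw [pow_zero, pow_zero, one_smul, Module.End.one_apply]
  | succ k ih => rw [pow_succ', Module.End.mul_apply, ih, map_smul, h₁, smul_smul, pow_succ]

theorem operatorB_mem_degreeLT {e : ℕ → S[X][X]} {k : ℕ}
    (he : ∀ j < k, e j ∈ degreeLT S[X] (k + 1)) {x : S[X][X]} (hx : x ∈ degreeLT S[X] k) :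
    operatorB q β γ e x ∈ degreeLT S[X] (k + 1) := by
  let D : Submodule S S[X][X] := (degreeLT S[X] (k + 1)).restrictScalars S
  have hX {i : ℕ} (hi : i < k + 1) : (X ^ i : S[X][X]) ∈ D :=
      mem_degreeLT.2 ((degree_X_pow_le i).trans_lt (Nat.cast_lt.2 hi))
  have hinvt : Set.MapsTo (commutationMap q β γ) (D.prod (D.prod D)) (D.prod (D.prod D)) := by
    rintro ⟨x, y, z⟩ ⟨hx, hy, hz⟩
    have hXsmul {w : S[X][X]} (hw : w ∈ D) : (X : S[X]) • w ∈ D :=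
      (degreeLT S[X] (k + 1)).smul_mem X hw
    exact ⟨sub_mem (add_mem (D.smul_of_tower_mem _ (hXsmul hx)) (D.smul_of_tower_mem _ hy))
        (D.smul_of_tower_mem _ (D.smul_mem γ hz)),
      add_mem (sub_mem (D.smul_of_tower_mem _ (hXsmul hy)) (D.smul_of_tower_mem _ hx))
        (D.smul_of_tower_mem _ (D.smul_mem β hz)), hXsmul hz⟩
  have hv (j : ℕ) (hj : j < k) : (X ^ (j + 1), e j, X ^ j) ∈ D.prod (D.prod D) :=
    ⟨hX (by lia), he j hj, hX (by lia)⟩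
  exact (intertwiner_mem hinvt hv hx).1

theorem valueC_mem_degreeLT (j : ℕ) : valueC q α β γ c j ∈ degreeLT S[X] (j + 1) := by
  induction j using Nat.strong_induction_on with
  | _ j ih =>
    cases j with
    | zero =>
      rw [valueC, mem_degreeLT]
      exact degree_C_le.trans_lt (by norm_num)
    | succ j =>
      have hX : (X ^ j : S[X][X]) ∈ degreeLT S[X] (j + 1 + 1) :=
        mem_degreeLT.2 ((degree_X_pow_le j).trans_lt (Nat.cast_lt.2 (by lia)))
      rw [valueC]
      refine sub_mem (add_mem (Submodule.smul_of_tower_mem _ _ (operatorB_mem_degreeLT q β γ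
        (fun i hi => ?_) (ih j j.lt_succ_self))) (Submodule.smul_of_tower_mem _ _
        (Submodule.smul_mem _ _ hX))) (Submodule.smul_of_tower_mem _ _
        (Submodule.smul_of_tower_mem _ _ hX))
      split_ifs
      · exact degreeLT_mono (by lia) (ih i hi)
      · exact zero_mem _

theorem valueC_succ (j : ℕ) : valueC q α β γ c (j + 1) =
    q ^ 2 • operatorB q β γ (valueC q α β γ c) (valueC q α β γ c j)
      + (q * (q ^ 2 - q⁻¹ ^ 2)) • (X : S[X]) • X ^ j - (q * (q - q⁻¹)) • α • X ^ j := by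
  have htrunc : operatorB q β γ (fun i => if _ : i ≤ j then valueC q α β γ c i else 0)
      (valueC q α β γ c j) = operatorB q β γ (valueC q α β γ c) (valueC q α β γ c j) :=
    congrArg Prod.fst (intertwiner_congr
      (fun i hi => by simp only [dif_pos (Nat.lt_succ_iff.1 hi)])
      (valueC_mem_degreeLT q α β γ c j))
  rw [valueC, htrunc]

variable {q}

theorem isAskeyWilsonTriple_operators (hq : q ≠ 0) :
    IsAskeyWilsonTriple q (Algebra.lsmul S S S[X][X] (X : S[X]))
      (operatorB q β γ (valueC q α β γ c)) (operatorC q β γ (valueC q α β γ c))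
      (algebraMap S _ α) (algebraMap S _ β) (algebraMap S _ γ) := by
  set a := Algebra.lsmul S S S[X][X] (X : S[X])
  set b := operatorB q β γ (valueC q α β γ c) with hb
  set k := operatorC q β γ (valueC q α β γ c) with hk
  have hba : b * a = q ^ 2 • (a * b) + (q * (q ^ 2 - q⁻¹ ^ 2)) • k
      - (q * (q - q⁻¹)) • algebraMap S _ γ :=
    LinearMap.ext (operatorB_X_smul q β γ _)
  have hka : k * a = q⁻¹ ^ 2 • (a * k) - (q⁻¹ * (q ^ 2 - q⁻¹ ^ 2)) • b
      + (q⁻¹ * (q - q⁻¹)) • algebraMap S _ β :=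
    LinearMap.ext (operatorC_X_smul q β γ _)
  have hak : a * k = q ^ 2 • (k * a) + (q * (q ^ 2 - q⁻¹ ^ 2)) • b
      - (q * (q - q⁻¹)) • algebraMap S _ β := by
    rw [hka]
    match_scalars <;> field_simp <;> ring
  have hD := commute_c_mul_b_sub (K := Module.End S S[X][X]) hq
    (Algebra.commute_algebraMap_left α a) (Algebra.commute_algebraMap_left β b)
    (Algebra.commute_algebraMap_left γ k) hba hak
  refine ⟨Algebra.commute_algebraMap_left α, Algebra.commute_algebraMap_left β,
    Algebra.commute_algebraMap_left γ, hba, ?_, hak⟩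
  refine sub_eq_zero.1 (eq_of_map_X_smul_of_map_X_pow (m := a) (LinearMap.congr_fun hD.eq)
    (fun _ => (map_zero a).symm) fun j => ?_)
  have hkb : k (b (X ^ j)) = q ^ 2 • b (k (X ^ j))
      + (q * (q ^ 2 - q⁻¹ ^ 2)) • (X : S[X]) • X ^ j - (q * (q - q⁻¹)) • α • X ^ j := by
    rw [hb, operatorB_X_pow, hk, operatorC_X_pow, operatorC_X_pow, valueC_succ]
  exact sub_eq_zero.2 hkb

end Representation

section WordFiltration

variable {F K ι : Type*} [Field F] [Ring K] [Algebra F K] {x : ι → K} {m n : ℕ} {y z w : K} {c : F}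

variable (F) in
/-- The span of the products of at most `n` members of the family `x`. -/
def wordsLE (x : ι → K) (n : ℕ) : Submodule F K :=
  Submodule.span F (insert 1 (Set.range x)) ^ n

variable (F) in
/-- The span of the products of fewer than `n` members of the family `x`. -/
def wordsLT (x : ι → K) : ℕ → Submodule F K
  | 0 => ⊥
  | n + 1 => wordsLE F x n

theorem mul_mem_wordsLE (hy : y ∈ wordsLE F x m) (hz : z ∈ wordsLE F x n) :
    y * z ∈ wordsLE F x (m + n) := by
  rw [wordsLE, pow_add]
  exact Submodule.mul_mem_mul hy hz

theorem one_mem_wordsLE (n : ℕ) : (1 : K) ∈ wordsLE F x n := by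
  rw [← one_pow n]
  exact Submodule.pow_mem_pow _ (Submodule.subset_span (Set.mem_insert _ _)) n

theorem mem_wordsLE_one (i : ι) : x i ∈ wordsLE F x 1 := by
  rw [wordsLE, pow_one]
  exact Submodule.subset_span (Set.mem_insert_of_mem _ ⟨i, rfl⟩)

theorem pow_mem_wordsLE (hy : y ∈ wordsLE F x n) (k : ℕ) : y ^ k ∈ wordsLE F x (k * n) := by
  rw [wordsLE, mul_comm, pow_mul]
  exact Submodule.pow_mem_pow _ hy k

theorem wordsLE_mono : Monotone (wordsLE F x) :=
  monotone_nat_of_le_succ fun n y hy => by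
    simpa only [mul_one] using mul_mem_wordsLE hy (one_mem_wordsLE 1)

theorem wordsLE_le_wordsLT (h : m < n) : wordsLE F x m ≤ wordsLT F x n := by
  cases n with
  | zero => exact absurd h m.not_lt_zero
  | succ n => exact wordsLE_mono (Nat.le_of_lt_succ h)

theorem wordsLT_le_wordsLE (n : ℕ) : wordsLT F x n ≤ wordsLE F x n := by
  cases n with
  | zero => exact bot_le
  | succ n => exact wordsLE_mono n.le_succ

theorem mul_mem_wordsLT_left (hy : y ∈ wordsLT F x m) (hz : z ∈ wordsLE F x n) :
    y * z ∈ wordsLT F x (m + n) := by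
  cases m with
  | zero =>
    rw [(Submodule.mem_bot F).1 hy, zero_mul]
    exact zero_mem _
  | succ m => exact wordsLE_le_wordsLT (by lia) (mul_mem_wordsLE hy hz)

theorem mul_mem_wordsLT_right (hy : y ∈ wordsLE F x m) (hz : z ∈ wordsLT F x n) :
    y * z ∈ wordsLT F x (m + n) := by
  cases n with
  | zero =>
    rw [(Submodule.mem_bot F).1 hz, mul_zero]
    exact zero_mem _
  | succ n => exact wordsLE_le_wordsLT (by lia) (mul_mem_wordsLE hy hz)

theorem exists_mem_wordsLE (hz : z ∈ Algebra.adjoin F (Set.range x)) : ∃ n, z ∈ wordsLE F x n := by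
  induction hz using Algebra.adjoin_induction with
  | mem y hy =>
    obtain ⟨i, rfl⟩ := hy
    exact ⟨1, mem_wordsLE_one i⟩
  | algebraMap r =>
    rw [Algebra.algebraMap_eq_smul_one]
    exact ⟨0, Submodule.smul_mem _ _ (one_mem_wordsLE 0)⟩
  | add y z _ _ hy hz =>
    obtain ⟨m, hm⟩ := hy
    obtain ⟨n, hn⟩ := hz
    exact ⟨max m n, add_mem (wordsLE_mono (le_max_left m n) hm)
      (wordsLE_mono (le_max_right m n) hn)⟩
  | mul y z _ _ hy hz =>
    obtain ⟨m, hm⟩ := hy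
    obtain ⟨n, hn⟩ := hz
    exact ⟨m + n, mul_mem_wordsLE hm hn⟩

variable (F) in
/-- The elements `y` and `z` agree up to a nonzero scalar and words of length less than `n`. -/
def LeadingAssociated (x : ι → K) (n : ℕ) (y z : K) : Prop :=
  ∃ c : F, c ≠ 0 ∧ y - c • z ∈ wordsLT F x n

namespace LeadingAssociated

theorem of_sub_mem (h : y - z ∈ wordsLT F x n) : LeadingAssociated F x n y z :=
  ⟨1, one_ne_zero, (one_smul F z).symm ▸ h⟩

theorem refl (y : K) : LeadingAssociated F x n y y :=
  of_sub_mem ((sub_self y).symm ▸ zero_mem _)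

theorem trans (h₁ : LeadingAssociated F x n y z) (h₂ : LeadingAssociated F x n z w) :
    LeadingAssociated F x n y w := by
  obtain ⟨c₁, hc₁, h₁⟩ := h₁
  obtain ⟨c₂, hc₂, h₂⟩ := h₂
  refine ⟨c₁ * c₂, mul_ne_zero hc₁ hc₂, ?_⟩
  have heq : y - (c₁ * c₂) • w = (y - c₁ • z) + c₁ • (z - c₂ • w) := by module
  exact heq ▸ add_mem h₁ (Submodule.smul_mem _ _ h₂)

theorem mul_left (h : LeadingAssociated F x n y z) (hw : w ∈ wordsLE F x m) :
    LeadingAssociated F x (m + n) (w * y) (w * z) := by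
  obtain ⟨c, hc, h⟩ := h
  refine ⟨c, hc, ?_⟩
  rw [← mul_smul_comm, ← mul_sub]
  exact mul_mem_wordsLT_right hw h

theorem mul_right (h : LeadingAssociated F x n y z) (hw : w ∈ wordsLE F x m) :
    LeadingAssociated F x (n + m) (y * w) (z * w) := by
  obtain ⟨c, hc, h⟩ := h
  refine ⟨c, hc, ?_⟩
  rw [← smul_mul_assoc, ← sub_mul]
  exact mul_mem_wordsLT_left h hw

theorem mem_wordsLE (h : LeadingAssociated F x n y z) (hz : z ∈ wordsLE F x n) :
    y ∈ wordsLE F x n := by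
  obtain ⟨c, -, h⟩ := h
  exact (Submodule.sub_mem_iff_left _ (Submodule.smul_mem _ c hz)).1 (wordsLT_le_wordsLE n h)

end LeadingAssociated

theorem aeval_chebyshevC_mem_wordsLE (hy : y ∈ wordsLE F x 1) (n : ℕ) :
    Polynomial.aeval y (Polynomial.Chebyshev.C F n) ∈ wordsLE F x n := by
  induction n using Nat.twoStepInduction with
  | zero =>
    rw [Nat.cast_zero, Polynomial.Chebyshev.C_zero, ← one_add_one_eq_two, map_add, map_one]
    exact add_mem (one_mem_wordsLE 0) (one_mem_wordsLE 0)
  | one =>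
    rw [Nat.cast_one, Polynomial.Chebyshev.C_one, Polynomial.aeval_X]
    exact hy
  | more n ih₀ ih₁ =>
    rw [Nat.cast_add, Nat.cast_two, Polynomial.Chebyshev.C_add_two, map_sub, map_mul,
      Polynomial.aeval_X, ← Nat.cast_succ]
    have hmul := mul_mem_wordsLE hy ih₁
    rw [add_comm] at hmul
    exact sub_mem hmul (wordsLE_mono (Nat.le_add_right n 2) ih₀)

theorem leadingAssociated_aeval_chebyshevC (hy : y ∈ wordsLE F x 1) (hn : 0 < n) :
    LeadingAssociated F x n (Polynomial.aeval y (Polynomial.Chebyshev.C F n)) (y ^ n) := by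
  refine .of_sub_mem ?_
  induction n, hn using Nat.le_induction with
  | base =>
    rw [Nat.cast_one, Polynomial.Chebyshev.C_one, Polynomial.aeval_X, pow_one, sub_self]
    exact zero_mem _
  | succ n hn ih =>
    obtain ⟨n, rfl⟩ := Nat.exists_eq_succ_of_ne_zero (Nat.ne_of_gt hn)
    have heq : Polynomial.aeval y (Polynomial.Chebyshev.C F ((n + 1 + 1 : ℕ) : ℤ)) - y ^ (n + 1 + 1)
        = y * (Polynomial.aeval y (Polynomial.Chebyshev.C F ((n + 1 : ℕ) : ℤ)) - y ^ (n + 1))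
          - Polynomial.aeval y (Polynomial.Chebyshev.C F n) := by
      rw [Nat.cast_add, Nat.cast_succ, Nat.cast_one, add_assoc (n : ℤ), one_add_one_eq_two,
        Polynomial.Chebyshev.C_add_two, map_sub, map_mul, Polynomial.aeval_X, mul_sub, ← pow_succ']
      abel
    have hmul := mul_mem_wordsLT_right hy ih
    rw [add_comm] at hmul
    exact heq ▸ sub_mem hmul
      (wordsLE_le_wordsLT (Nat.lt_add_of_pos_right two_pos) (aeval_chebyshevC_mem_wordsLE hy n))

/-- The elements `y` of degree `m` and `z` of degree `n` commute up to the scalar `c` and words of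
length less than `m + n`. -/
structure QCommute (x : ι → K) (m n : ℕ) (y z : K) (c : F) : Prop where
  left_mem : y ∈ wordsLE F x m
  right_mem : z ∈ wordsLE F x n
  sub_mem : y * z - c • (z * y) ∈ wordsLT F x (m + n)

namespace QCommute

theorem of_commute (hy : y ∈ wordsLE F x m) (hz : z ∈ wordsLE F x n) (h : Commute y z) :
    QCommute x m n y z (1 : F) :=
  ⟨hy, hz, by rw [one_smul, h.eq, sub_self]; exact zero_mem _⟩

theorem mul_left {m₁ m₂ : ℕ} {y₁ y₂ : K} {c₁ c₂ : F} (h₁ : QCommute x m₁ n y₁ z c₁)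
    (h₂ : QCommute x m₂ n y₂ z c₂) : QCommute x (m₁ + m₂) n (y₁ * y₂) z (c₁ * c₂) := by
  refine ⟨mul_mem_wordsLE h₁.left_mem h₂.left_mem, h₁.right_mem, ?_⟩
  have heq : y₁ * y₂ * z - (c₁ * c₂) • (z * (y₁ * y₂)) =
      y₁ * (y₂ * z - c₂ • (z * y₂)) + c₂ • ((y₁ * z - c₁ • (z * y₁)) * y₂) := by
    simp only [mul_sub, sub_mul, mul_smul_comm, smul_mul_assoc, mul_assoc]
    module
  rw [heq]
  refine add_mem ?_ (Submodule.smul_mem _ _ ?_)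
  · rw [add_assoc]
    exact mul_mem_wordsLT_right h₁.left_mem h₂.sub_mem
  · rw [add_right_comm]
    exact mul_mem_wordsLT_left h₁.sub_mem h₂.left_mem

theorem pow_left (h : QCommute x m n y z c) (k : ℕ) : QCommute x (k * m) n (y ^ k) z (c ^ k) := by
  induction k with
  | zero =>
    rw [zero_mul, pow_zero, pow_zero]
    exact of_commute (one_mem_wordsLE 0) h.right_mem (Commute.one_left z)
  | succ k ih =>
    rw [pow_succ, pow_succ, Nat.succ_mul]
    exact ih.mul_left h

theorem symm (h : QCommute x m n y z c) (hc : c ≠ 0) : QCommute x n m z y c⁻¹ := by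
  refine ⟨h.right_mem, h.left_mem, ?_⟩
  have heq : z * y - c⁻¹ • (y * z) = (-c⁻¹) • (y * z - c • (z * y)) := by
    match_scalars <;> field_simp
  rw [heq, add_comm]
  exact Submodule.smul_mem _ _ h.sub_mem

theorem leadingAssociated (h : QCommute x m n y z c) (hc : c ≠ 0) :
    LeadingAssociated F x (m + n) (y * z) (z * y) :=
  ⟨c, hc, h.sub_mem⟩

end QCommute

/-- The product of the powers `x i ^ e i`, taken in the order of the list `l`. -/
def orderedMonomial (x : ι → K) (l : List ι) (e : ι → ℕ) : K :=
  (l.map fun i => x i ^ e i).prod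

theorem orderedMonomial_cons (x : ι → K) (i : ι) (l : List ι) (e : ι → ℕ) :
    orderedMonomial x (i :: l) e = x i ^ e i * orderedMonomial x l e :=
  List.prod_cons

theorem pow_mem_wordsLE_self (i : ι) (k : ℕ) : x i ^ k ∈ wordsLE F x k := by
  simpa only [mul_one] using pow_mem_wordsLE (F := F) (mem_wordsLE_one (x := x) i) k

variable (l : List ι) (e f : ι → ℕ)

theorem orderedMonomial_mem_wordsLE : orderedMonomial x l e ∈ wordsLE F x (l.map e).sum := by
  induction l with
  | nil => exact one_mem_wordsLE 0
  | cons i l ih =>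
    rw [orderedMonomial_cons, List.map_cons, List.sum_cons]
    exact mul_mem_wordsLE (pow_mem_wordsLE_self i (e i)) ih

theorem qCommute_orderedMonomial {c : ι → F} (hz : z ∈ wordsLE F x n)
    (h : ∀ i, QCommute x 1 n (x i) z (c i)) :
    QCommute x (l.map e).sum n (orderedMonomial x l e) z (orderedMonomial c l e) := by
  induction l with
  | nil => exact QCommute.of_commute (one_mem_wordsLE 0) hz (Commute.one_left z)
  | cons i l ih =>
    rw [orderedMonomial_cons, orderedMonomial_cons, List.map_cons, List.sum_cons]
    simpa only [mul_one] using ((h i).pow_left (e i)).mul_left ih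

theorem orderedMonomial_ne_zero {c : ι → F} (hc : ∀ i, c i ≠ 0) : orderedMonomial c l e ≠ 0 :=
  List.prod_ne_zero fun h => by
    obtain ⟨i, -, hi⟩ := List.mem_map.1 h
    exact pow_ne_zero _ (hc i) hi

theorem orderedMonomial_mul {c : ι → ι → F} (h : ∀ i j, QCommute x 1 1 (x i) (x j) (c i j))
    (hc : ∀ i j, c i j ≠ 0) :
    LeadingAssociated F x ((l.map e).sum + (l.map f).sum)
      (orderedMonomial x l e * orderedMonomial x l f) (orderedMonomial x l (e + f)) := by
  induction l with
  | nil => exact (mul_one (1 : K)).symm ▸ .refl _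
  | cons i l ih =>
    have hQ := qCommute_orderedMonomial l e (mem_wordsLE_one i) (h · i)
    have hc₀ := orderedMonomial_ne_zero l e (hc · i)
    have hswap := (((hQ.symm hc₀).pow_left (f i)).symm
      (pow_ne_zero _ (inv_ne_zero hc₀))).leadingAssociated
      (inv_ne_zero (pow_ne_zero _ (inv_ne_zero hc₀)))
    have h₁ := (hswap.mul_left (pow_mem_wordsLE_self i (e i))).mul_right
      (orderedMonomial_mem_wordsLE l f)
    have h₂ := ih.mul_left (pow_mem_wordsLE_self i (e i + f i))
    simp only [orderedMonomial_cons, List.map_cons, List.sum_cons, Pi.add_apply]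
    convert h₁.trans ?_ using 1
    · lia
    · simp only [mul_assoc]
    · convert h₂ using 1
      · lia
      · simp only [pow_add, mul_assoc]

end WordFiltration

end AskeyWilson

open AskeyWilson in
theorem IsAskeyWilsonTriple.qCommute_b_a {F K ι : Type*} [Field F] [Ring K]
    [Algebra F K] {q : F} {a b c α β γ : K} (h : IsAskeyWilsonTriple q a b c α β γ) {x : ι → K}
    (ha : a ∈ wordsLE F x 1) (hb : b ∈ wordsLE F x 1) (hc : c ∈ wordsLE F x 1)
    (hγ : γ ∈ wordsLE F x 1) : QCommute x 1 1 b a (q ^ 2) := by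
  refine ⟨hb, ha, ?_⟩
  rw [h.b_mul_a, add_sub_assoc, add_sub_cancel_left]
  exact sub_mem (Submodule.smul_mem _ _ hc) (Submodule.smul_mem _ _ hγ)

namespace UAW

open AskeyWilson

variable {F : Type*} [Field F] {q : F}

section OrderedMonomials

/-- The order of the generators in the ordered monomials of the Poincaré--Birkhoff--Witt basis. -/
def pbwOrder : List UAWGen := [.A, .B, .C, .α, .β, .γ]

variable (F q) in
/-- The ordered monomial `A ^ e A * B ^ e B * C ^ e C * α ^ e α * β ^ e β * γ ^ e γ`. -/
noncomputable def pbw (e : UAWGen →₀ ℕ) : UAW F q :=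
  orderedMonomial (gen F q) pbwOrder e

theorem sum_map_pbwOrder (e : UAWGen →₀ ℕ) : (pbwOrder.map e).sum = e.degree := by
  induction e using Finsupp.induction_linear with
  | zero => simp [pbwOrder]
  | add e f he hf =>
    rw [map_add, ← he, ← hf, ← List.sum_map_add]
    rfl
  | single g k => cases g <;> simp [pbwOrder]

theorem orderedMonomial_X_pbwOrder {R : Type*} [CommRing R] (e : UAWGen →₀ ℕ) :
    orderedMonomial (MvPolynomial.X (R := R)) pbwOrder e = MvPolynomial.monomial e 1 := by
  induction e using Finsupp.induction_linear with
  | zero => simp [pbwOrder, orderedMonomial]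
  | add e f he hf =>
    rw [← one_mul (1 : R), ← MvPolynomial.monomial_mul, ← he, ← hf, orderedMonomial,
      orderedMonomial, orderedMonomial, ← List.prod_map_mul]
    simp only [Finsupp.add_apply, pow_add]
  | single g k =>
    rw [← MvPolynomial.X_pow_eq_monomial]
    cases g <;> simp [pbwOrder, orderedMonomial]

theorem pbw_zero : pbw F q 0 = 1 := by
  simp [pbw, pbwOrder, orderedMonomial]

theorem pbw_single (g : UAWGen) : pbw F q (.single g 1) = gen F q g := by
  cases g <;> simp [pbw, pbwOrder, orderedMonomial]

theorem pbw_mem_wordsLE (e : UAWGen →₀ ℕ) : pbw F q e ∈ wordsLE F (gen F q) e.degree :=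
  sum_map_pbwOrder e ▸ orderedMonomial_mem_wordsLE pbwOrder e

end OrderedMonomials

section LinearIndependence

open Polynomial

/-- The representation of the universal Askey--Wilson algebra on polynomials in two variables over
`F[A, B, C, α, β, γ]` in which `A` acts as multiplication by the inner variable. -/
noncomputable def polynomialRep (hq : q ≠ 0) :
    UAW F q →ₐ[F] Module.End (MvPolynomial UAWGen F) (MvPolynomial UAWGen F)[X][X] :=
  lift hq (isAskeyWilsonTriple_operators (.X .α) (.X .β) (.X .γ) (.X .C) hq)

/-- The symbol of an element: its action on `1` in `UAW.polynomialRep`, with the two polynomial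
variables renamed to `A` and `B`. -/
noncomputable def symbol (hq : q ≠ 0) : UAW F q →ₗ[F] MvPolynomial UAWGen F :=
  ((aevalAeval (R := MvPolynomial UAWGen F) (.X .A) (.X .B)).toLinearMap.restrictScalars F) ∘ₗ
    (LinearMap.applyₗ (R := MvPolynomial UAWGen F) 1).restrictScalars F ∘ₗ
      (polynomialRep hq).toLinearMap

theorem symbol_pbw (hq : q ≠ 0) (e : UAWGen →₀ ℕ) :
    symbol hq (pbw F q e) = MvPolynomial.monomial e 1 := by
  have hscalar (s : MvPolynomial UAWGen F) (k : ℕ) (y : (MvPolynomial UAWGen F)[X][X]) :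
      (algebraMap _ (Module.End (MvPolynomial UAWGen F) (MvPolynomial UAWGen F)[X][X]) s ^ k) y =
        s ^ k • y := by
    rw [← map_pow, Module.algebraMap_end_apply]
  have hX (k : ℕ) (y : (MvPolynomial UAWGen F)[X][X]) :
      (Algebra.lsmul (MvPolynomial UAWGen F) (MvPolynomial UAWGen F) _
        (X : (MvPolynomial UAWGen F)[X]) ^ k) y = Polynomial.C X ^ k * y := by
    rw [← map_pow, ← C_pow, ← smul_eq_C_mul]
    rfl
  have haction : polynomialRep hq (pbw F q e) 1 =
      (.X .α ^ e .α * .X .β ^ e .β * .X .γ ^ e .γ * .X .C ^ e .C : MvPolynomial UAWGen F) •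
        (Polynomial.C X ^ e .A * X ^ e .B) := by
    simp only [polynomialRep, pbw, orderedMonomial, pbwOrder, List.map_cons, List.map_nil,
      List.prod_cons, List.prod_nil, map_mul, map_one, map_pow, lift_gen, liftGen,
      Module.End.mul_apply, Module.End.one_apply, hscalar, hX, map_smul, operatorB_pow_one,
      operatorC_pow_one, mul_smul_comm, smul_smul, mul_assoc]
  change aevalAeval _ _ (polynomialRep hq (pbw F q e) 1) = _
  rw [haction, map_smul, map_mul, map_pow, map_pow, aevalAeval_X, aevalAeval_Y,
    ← orderedMonomial_X_pbwOrder]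
  simp only [orderedMonomial, pbwOrder, List.map_cons, List.map_nil, List.prod_cons,
    List.prod_nil, smul_eq_mul]
  ring

theorem linearIndependent_pbw (hq : q ≠ 0) : LinearIndependent F (pbw F q) := by
  have hcomp : symbol hq ∘ pbw F q = MvPolynomial.basisMonomials UAWGen F := by
    rw [MvPolynomial.coe_basisMonomials]
    exact funext (symbol_pbw hq)
  exact .of_comp (symbol hq) (hcomp ▸ (MvPolynomial.basisMonomials UAWGen F).linearIndependent)

end LinearIndependence

section Spanning

/-- The scalar `c` with `x * y = c • (y * x) + ⋯` up to shorter words, for generators `x`, `y`. -/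
def qFactor (q : F) : UAWGen → UAWGen → F
  | .B, .A | .C, .B | .A, .C => q ^ 2
  | .A, .B | .B, .C | .C, .A => (q ^ 2)⁻¹
  | _, _ => 1

theorem qFactor_ne_zero (hq : q ≠ 0) (g h : UAWGen) : qFactor q g h ≠ 0 := by
  cases g <;> cases h <;> simp [qFactor, hq]

theorem qCommute_gen (hq : q ≠ 0) (g h : UAWGen) :
    QCommute (gen F q) 1 1 (gen F q g) (gen F q h) (qFactor q g h) := by
  have hAW := isAskeyWilsonTriple hq
  have hmem (g : UAWGen) : gen F q g ∈ wordsLE F (gen F q) 1 := mem_wordsLE_one g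
  have hBA := hAW.qCommute_b_a (hmem .A) (hmem .B) (hmem .C) (hmem .γ)
  have hCB := hAW.rotate.qCommute_b_a (hmem .B) (hmem .C) (hmem .A) (hmem .α)
  have hAC := hAW.rotate.rotate.qCommute_b_a (hmem .C) (hmem .A) (hmem .B) (hmem .β)
  have hcomm {g h : UAWGen} (hgh : Commute (gen F q g) (gen F q h)) :
      QCommute (gen F q) 1 1 (gen F q g) (gen F q h) (1 : F) :=
    .of_commute (hmem g) (hmem h) hgh
  have hq2 : q ^ 2 ≠ 0 := pow_ne_zero 2 hq
  cases g <;> cases h <;> first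
    | exact hcomm (hAW.comm_α _)
    | exact hcomm (hAW.comm_β _)
    | exact hcomm (hAW.comm_γ _)
    | exact hcomm (hAW.comm_α _).symm
    | exact hcomm (hAW.comm_β _).symm
    | exact hcomm (hAW.comm_γ _).symm
    | exact hcomm rfl
    | exact hBA
    | exact hCB
    | exact hAC
    | exact hBA.symm hq2
    | exact hCB.symm hq2
    | exact hAC.symm hq2

/-- The element `y` is a nonzero multiple of the ordered monomial with exponents `e`, up to shorter
words. -/
def HasLeadingExponent (y : UAW F q) (e : UAWGen →₀ ℕ) : Prop :=
  LeadingAssociated F (gen F q) e.degree y (pbw F q e)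

namespace HasLeadingExponent

variable {y z : UAW F q} {e f : UAWGen →₀ ℕ}

theorem mem_wordsLE (h : HasLeadingExponent y e) : y ∈ wordsLE F (gen F q) e.degree :=
  LeadingAssociated.mem_wordsLE h (pbw_mem_wordsLE e)

theorem mul (hq : q ≠ 0) (hy : HasLeadingExponent y e) (hz : HasLeadingExponent z f) :
    HasLeadingExponent (y * z) (e + f) := by
  have hpbw := orderedMonomial_mul pbwOrder e f (qCommute_gen (F := F) hq) (qFactor_ne_zero hq)
  rw [sum_map_pbwOrder, sum_map_pbwOrder] at hpbw
  rw [HasLeadingExponent, map_add]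
  exact (LeadingAssociated.mul_right hy hz.mem_wordsLE).trans
    ((LeadingAssociated.mul_left hz (pbw_mem_wordsLE e)).trans hpbw)

theorem pow (hq : q ≠ 0) (hy : HasLeadingExponent y e) (k : ℕ) :
    HasLeadingExponent (y ^ k) (k • e) := by
  induction k with
  | zero =>
    rw [pow_zero, zero_smul, ← pbw_zero]
    exact LeadingAssociated.refl _
  | succ k ih =>
    rw [pow_succ, succ_nsmul]
    exact ih.mul hq hy

end HasLeadingExponent

theorem hasLeadingExponent_gen (g : UAWGen) : HasLeadingExponent (gen F q g) (.single g 1) :=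
  pbw_single (F := F) (q := q) g ▸ LeadingAssociated.refl _

theorem wordsLE_le_span_pbw (hq : q ≠ 0) (n : ℕ) :
    wordsLE F (gen F q) n ≤ Submodule.span F (pbw F q '' {e | e.degree ≤ n}) := by
  induction n with
  | zero =>
    rw [wordsLE, pow_zero, Submodule.one_le]
    exact Submodule.subset_span ⟨0, by simp, pbw_zero⟩
  | succ n ih =>
    have hmono : Submodule.span F (pbw F q '' {e | e.degree ≤ n}) ≤
        Submodule.span F (pbw F q '' {e | e.degree ≤ n + 1}) :=
      Submodule.span_mono (Set.image_mono fun _ he => Nat.le_succ_of_le he)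
    have hfactor : wordsLE F (gen F q) (n + 1) ≤
        Submodule.span F (insert 1 (Set.range (gen F q))) *
          Submodule.span F (pbw F q '' {e | e.degree ≤ n}) := by
      rw [wordsLE, pow_succ']
      exact mul_le_mul_right ih _
    refine hfactor.trans ?_
    rw [Submodule.span_mul_span, Submodule.span_le, Set.mul_subset_iff]
    rintro _ (rfl | ⟨g, rfl⟩) _ ⟨e, he, rfl⟩
    · rw [one_mul]
      exact hmono (Submodule.subset_span ⟨e, he, rfl⟩)
    · obtain ⟨c, -, hc⟩ := (hasLeadingExponent_gen g).mul hq (LeadingAssociated.refl (pbw F q e))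
      have hdeg : (Finsupp.single g 1 + e).degree = e.degree + 1 := by
        rw [map_add, Finsupp.degree_single, add_comm]
      rw [hdeg] at hc
      rw [← sub_add_cancel (gen F q g * pbw F q e) (c • pbw F q (.single g 1 + e))]
      exact add_mem (hmono (ih (wordsLE_mono he hc))) (Submodule.smul_mem _ _
        (Submodule.subset_span ⟨_, hdeg.trans_le (Nat.succ_le_succ he), rfl⟩))

/-- The Poincaré--Birkhoff--Witt basis of ordered monomials. -/
noncomputable def pbwBasis (hq : q ≠ 0) : Module.Basis (UAWGen →₀ ℕ) F (UAW F q) :=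
  .mk (linearIndependent_pbw hq) fun z _ => by
    have hz : z ∈ Algebra.adjoin F (Set.range (gen F q)) := adjoin_range_gen F q ▸ Algebra.mem_top
    obtain ⟨n, hn⟩ := exists_mem_wordsLE hz
    exact Submodule.span_mono (Set.image_subset_range _ _) (wordsLE_le_span_pbw hq n hn)

theorem coe_pbwBasis (hq : q ≠ 0) : ⇑(pbwBasis hq) = pbw F q :=
  Module.Basis.coe_mk _ _

theorem pbwBasis_repr_pbw (hq : q ≠ 0) (e : UAWGen →₀ ℕ) :
    (pbwBasis hq).repr (pbw F q e) = .single e 1 := by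
  rw [← coe_pbwBasis hq, Module.Basis.repr_self]

theorem pbwBasis_repr_eq_zero_of_mem_wordsLT (hq : q ≠ 0) {n : ℕ} {z : UAW F q}
    (hz : z ∈ wordsLT F (gen F q) n) {e : UAWGen →₀ ℕ} (he : n ≤ e.degree) :
    (pbwBasis hq).repr z e = 0 := by
  cases n with
  | zero => rw [(Submodule.mem_bot F).1 hz, map_zero, Finsupp.zero_apply]
  | succ n =>
    have hspan := wordsLE_le_span_pbw hq n hz
    rw [← coe_pbwBasis hq, Module.Basis.mem_span_image] at hspan
    by_contra hne
    exact (Nat.lt_of_succ_le he).not_ge (hspan (Finsupp.mem_support_iff.2 hne))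

end Spanning

section CentralExponents

theorem pbwBasis_repr_apply_add (hq : q ≠ 0) {f : UAW F q →ₗ[F] UAW F q}
    {s : UAWGen →₀ ℕ} {c : (UAWGen →₀ ℕ) → F}
    (hf : ∀ e, f (pbw F q e) - c e • pbw F q (e + s) ∈ wordsLT F (gen F q) (e + s).degree)
    {z : UAW F q} {e : UAWGen →₀ ℕ} (hz : z ∈ wordsLE F (gen F q) e.degree) :
    (pbwBasis hq).repr (f z) (e + s) = c e * (pbwBasis hq).repr z e := by
  have heq : Set.EqOn ((pbwBasis hq).coord (e + s) ∘ₗ f)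
      (c e • (pbwBasis hq).coord e : UAW F q →ₗ[F] F)
      (pbw F q '' {k | k.degree ≤ e.degree}) := by
    rintro _ ⟨k, hk, rfl⟩
    have hdeg : (k + s).degree ≤ (e + s).degree := by
      rw [map_add, map_add]
      exact Nat.add_le_add_right hk _
    have hrepr := pbwBasis_repr_eq_zero_of_mem_wordsLT hq (hf k) hdeg
    rw [map_sub, map_smul, pbwBasis_repr_pbw, Finsupp.sub_apply, sub_eq_zero] at hrepr
    rw [LinearMap.comp_apply, LinearMap.smul_apply, Module.Basis.coord_apply,
      Module.Basis.coord_apply, hrepr, pbwBasis_repr_pbw, Finsupp.smul_apply]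
    obtain rfl | hke := eq_or_ne k e
    · rw [Finsupp.single_eq_same, Finsupp.single_eq_same]
    · rw [Finsupp.single_eq_of_ne ((add_left_injective s).ne hke.symm),
        Finsupp.single_eq_of_ne hke.symm, smul_zero, smul_zero]
  exact LinearMap.eqOn_span heq (wordsLE_le_span_pbw hq _ hz)

theorem orderedMonomial_qFactor_eq_one_of_commute (hq : q ≠ 0) {g : UAWGen} {z : UAW F q}
    {e : UAWGen →₀ ℕ} (hz : z ∈ wordsLE F (gen F q) e.degree) (hcomm : Commute z (gen F q g))
    (hze : (pbwBasis hq).repr z e ≠ 0) :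
    orderedMonomial (qFactor q · g) pbwOrder e = 1 := by
  set χ : (UAWGen →₀ ℕ) → F := fun k => orderedMonomial (qFactor q · g) pbwOrder k
  have hχ (k : UAWGen →₀ ℕ) : pbw F q k * gen F q g - χ k • (gen F q g * pbw F q k) ∈
      wordsLT F (gen F q) (k + .single g 1).degree := by
    have hQ := qCommute_orderedMonomial (c := (qFactor q · g)) pbwOrder k (mem_wordsLE_one g)
      fun h => qCommute_gen hq h g
    rw [map_add, Finsupp.degree_single, ← sum_map_pbwOrder]
    exact hQ.sub_mem
  have hlead (k : UAWGen →₀ ℕ) : ∃ b : F, b ≠ 0 ∧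
      gen F q g * pbw F q k - b • pbw F q (k + .single g 1) ∈
        wordsLT F (gen F q) (k + .single g 1).degree :=
    add_comm k _ ▸ (hasLeadingExponent_gen g).mul hq (LeadingAssociated.refl (pbw F q k))
  choose b hb₀ hb using hlead
  have hcommutator (k : UAWGen →₀ ℕ) :
      (LinearMap.mulRight F (gen F q g) - LinearMap.mulLeft F (gen F q g)) (pbw F q k)
        - ((χ k - 1) * b k) • pbw F q (k + .single g 1) ∈
          wordsLT F (gen F q) (k + .single g 1).degree := by
    rw [LinearMap.sub_apply, LinearMap.mulRight_apply, LinearMap.mulLeft_apply]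
    have heq : pbw F q k * gen F q g - gen F q g * pbw F q k
        - ((χ k - 1) * b k) • pbw F q (k + .single g 1) =
          (pbw F q k * gen F q g - χ k • (gen F q g * pbw F q k))
          + (χ k - 1) • (gen F q g * pbw F q k - b k • pbw F q (k + .single g 1)) := by
      module
    exact heq ▸ add_mem (hχ k) (Submodule.smul_mem _ _ (hb k))
  have hrepr := pbwBasis_repr_apply_add hq hcommutator hz
  rw [LinearMap.sub_apply, LinearMap.mulRight_apply, LinearMap.mulLeft_apply, hcomm.eq, sub_self,
    map_zero, Finsupp.zero_apply, eq_comm] at hrepr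
  have hfactor := (mul_eq_zero.1 hrepr).resolve_right hze
  exact sub_eq_zero.1 ((mul_eq_zero.1 hfactor).resolve_right (hb₀ e))

theorem modEq_of_pow_mul_inv_pow_eq_one {ζ : F} {n : ℕ} (hn : IsPrimitiveRoot ζ n) (hζ : ζ ≠ 0)
    {i j : ℕ} (h : ζ ^ i * ζ⁻¹ ^ j = 1) : i ≡ j [MOD n] := by
  rw [Nat.modEq_iff_dvd, ← hn.zpow_eq_one_iff_dvd, zpow_sub₀ hζ, zpow_natCast, zpow_natCast,
    div_eq_one_iff_eq (pow_ne_zero i hζ)]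
  rwa [inv_pow, mul_inv_eq_one₀ (pow_ne_zero j hζ), eq_comm] at h

/-- The exponents of the ordered monomials that occur as leading terms of central elements, when
`q ^ 2` is a primitive `n`-th root of unity. -/
def IsCentralExponent (n : ℕ) (e : UAWGen →₀ ℕ) : Prop :=
  e .A ≡ e .B [MOD n] ∧ e .B ≡ e .C [MOD n]

theorem isCentralExponent_of_mem_center (hq : q ≠ 0) {n : ℕ} (hn : IsPrimitiveRoot (q ^ 2) n)
    {z : UAW F q} {e : UAWGen →₀ ℕ} (hz : z ∈ wordsLE F (gen F q) e.degree)
    (hc : z ∈ Subalgebra.center F (UAW F q)) (hze : (pbwBasis hq).repr z e ≠ 0) :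
    IsCentralExponent n e := by
  have hq2 : q ^ 2 ≠ 0 := pow_ne_zero 2 hq
  have hone (g : UAWGen) : orderedMonomial (qFactor q · g) pbwOrder e = 1 :=
    orderedMonomial_qFactor_eq_one_of_commute hq hz (Subalgebra.mem_center_iff.1 hc _).symm hze
  have hA := hone .A
  have hC := hone .C
  simp only [orderedMonomial, pbwOrder, qFactor, List.map_cons, List.map_nil, List.prod_cons,
    List.prod_nil, one_pow, one_mul, mul_one] at hA hC
  exact ⟨modEq_of_pow_mul_inv_pow_eq_one hn hq2 hC, modEq_of_pow_mul_inv_pow_eq_one hn hq2 hA⟩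

end CentralExponents

section LeadingFamilies

variable {ι : Type*} {u : ι → UAW F q} {e : ι → UAWGen →₀ ℕ}

theorem linearIndependent_of_hasLeadingExponent (hq : q ≠ 0) (he : Function.Injective e)
    (hu : ∀ i, HasLeadingExponent (u i) (e i)) : LinearIndependent F u := by
  choose c hc₀ hc using hu
  have hrepr {i j : ι} (hij : (e j).degree ≤ (e i).degree) :
      (pbwBasis hq).repr (u j) (e i) = Finsupp.single (e j) (c j) (e i) := by
    have hzero := pbwBasis_repr_eq_zero_of_mem_wordsLT hq (hc j) hij
    rwa [map_sub, map_smul, pbwBasis_repr_pbw, Finsupp.smul_single_one, Finsupp.sub_apply,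
      sub_eq_zero] at hzero
  rw [linearIndependent_iff]
  intro l hl
  by_contra hne
  obtain ⟨i, hi, hmax⟩ := Finset.exists_max_image l.support (fun i => (e i).degree)
    (Finsupp.support_nonempty_iff.2 hne)
  have hcoeff := congrArg ((pbwBasis hq).coord (e i)) hl
  rw [Finsupp.linearCombination_apply, Finsupp.sum, map_sum, map_zero,
    Finset.sum_eq_single_of_mem i hi, map_smul, Module.Basis.coord_apply, hrepr le_rfl,
    Finsupp.single_eq_same] at hcoeff
  · exact smul_ne_zero (Finsupp.mem_support_iff.1 hi) (hc₀ i) hcoeff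
  · intro j hj hji
    rw [map_smul, Module.Basis.coord_apply, hrepr (hmax j hj),
      Finsupp.single_eq_of_ne (he.ne hji.symm), smul_zero]

theorem mem_span_sup_wordsLT (hq : q ≠ 0) (hu : ∀ i, HasLeadingExponent (u i) (e i)) {n : ℕ}
    {z : UAW F q} (hz : z ∈ wordsLE F (gen F q) n)
    (hlead : ∀ k, k.degree = n → (pbwBasis hq).repr z k ≠ 0 → k ∈ Set.range e) :
    z ∈ Submodule.span F (Set.range u) ⊔ wordsLT F (gen F q) n := by
  rw [← (pbwBasis hq).linearCombination_repr z, Finsupp.linearCombination_apply, coe_pbwBasis]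
  refine Submodule.sum_mem _ fun k hk => Submodule.smul_mem _ _ ?_
  rw [Finsupp.mem_support_iff] at hk
  have hkn : k.degree ≤ n := by
    by_contra hlt
    exact hk (pbwBasis_repr_eq_zero_of_mem_wordsLT hq (n := n + 1) hz (not_le.1 hlt))
  obtain hlt | heq := hkn.lt_or_eq
  · exact Submodule.mem_sup_right (wordsLE_le_wordsLT hlt (pbw_mem_wordsLE k))
  · obtain ⟨i, rfl⟩ := hlead k heq hk
    obtain ⟨c, hc₀, hc⟩ := hu i
    have hsplit : pbw F q (e i) = c⁻¹ • u i + (-c⁻¹) • (u i - c • pbw F q (e i)) := by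
      match_scalars <;> field_simp
      ring
    exact hsplit ▸ Submodule.add_mem_sup
      (Submodule.smul_mem _ _ (Submodule.subset_span ⟨i, rfl⟩)) (Submodule.smul_mem _ _ (heq ▸ hc))

theorem center_le_span_of_hasLeadingExponent (hq : q ≠ 0) {n : ℕ}
    (hn : IsPrimitiveRoot (q ^ 2) n) (hc : ∀ i, u i ∈ Subalgebra.center F (UAW F q))
    (hu : ∀ i, HasLeadingExponent (u i) (e i))
    (he : ∀ k, IsCentralExponent n k → k ∈ Set.range e) :
    Subalgebra.toSubmodule (Subalgebra.center F (UAW F q)) ≤ Submodule.span F (Set.range u) := by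
  have hspan : Submodule.span F (Set.range u) ≤
      Subalgebra.toSubmodule (Subalgebra.center F (UAW F q)) :=
    Submodule.span_le.2 (Set.range_subset_iff.2 hc)
  have hfilt (m : ℕ) : ∀ z ∈ Subalgebra.center F (UAW F q), z ∈ wordsLT F (gen F q) m →
      z ∈ Submodule.span F (Set.range u) := by
    induction m with
    | zero => exact fun z _ hz => (Submodule.mem_bot F).1 hz ▸ zero_mem _
    | succ m ih =>
      intro z hzc hz
      obtain ⟨v, hv, w, hw, rfl⟩ := Submodule.mem_sup.1 <|
        mem_span_sup_wordsLT hq hu hz fun k hk hzk =>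
          he k (isCentralExponent_of_mem_center hq hn (hk ▸ hz) hzc hzk)
      exact add_mem hv (ih w ((Submodule.add_mem_iff_right _ (hspan hv)).1 hzc) hw)
  intro z hz
  obtain ⟨m, hm⟩ := exists_mem_wordsLE (F := F) (x := gen F q)
    (adjoin_range_gen F q ▸ Algebra.mem_top : z ∈ Algebra.adjoin F (Set.range (gen F q)))
  exact hfilt (m + 1) z hz hm

end LeadingFamilies

variable {n : ℕ}

section LeadingExponents

theorem hasLeadingExponent_T_gen (hq : q ≠ 0) (hn : 0 < n) (g : UAWGen) :
    HasLeadingExponent (T F q n (gen F q g)) (n • .single g 1) := by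
  have hpow := (hasLeadingExponent_gen g).pow (F := F) hq n
  rw [HasLeadingExponent, map_nsmul, Finsupp.degree_single, smul_eq_mul, mul_one] at hpow ⊢
  exact (leadingAssociated_aeval_chebyshevC (mem_wordsLE_one g) hn).trans hpow

theorem hasLeadingExponent_Ω (hq : q ≠ 0) :
    HasLeadingExponent (Ω F q) (.single .A 1 + .single .B 1 + .single .C 1) := by
  have hABC := ((hasLeadingExponent_gen (F := F) .A).mul hq (hasLeadingExponent_gen .B)).mul hq
    (hasLeadingExponent_gen .C)
  have hmul (g h : UAWGen) : gen F q g * gen F q h ∈ wordsLE F (gen F q) 2 :=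
    mul_mem_wordsLE (mem_wordsLE_one g) (mem_wordsLE_one h)
  have heq : Ω F q - (-q) • (A F q * B F q * C F q) =
      (q ^ 2 + q⁻¹ ^ 2) • 1 - q ^ 2 • (A F q * A F q) - q⁻¹ ^ 2 • (B F q * B F q)
        - q ^ 2 • (C F q * C F q) + q • (A F q * α F q) + q⁻¹ • (B F q * β F q)
        + q • (C F q * γ F q) := by
    rw [Ω, Algebra.algebraMap_eq_smul_one, pow_two (A F q), pow_two (B F q), pow_two (C F q)]
    module
  have hΩ : Ω F q - (-q) • (A F q * B F q * C F q) ∈ wordsLT F (gen F q) 3 := by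
    rw [heq]
    exact add_mem (add_mem (add_mem (sub_mem (sub_mem (sub_mem
      (Submodule.smul_mem _ _ (one_mem_wordsLE 2)) (Submodule.smul_mem _ _ (hmul .A .A)))
      (Submodule.smul_mem _ _ (hmul .B .B))) (Submodule.smul_mem _ _ (hmul .C .C)))
      (Submodule.smul_mem _ _ (hmul .A .α))) (Submodule.smul_mem _ _ (hmul .B .β)))
      (Submodule.smul_mem _ _ (hmul .C .γ))
  rw [HasLeadingExponent] at hABC ⊢
  simp only [map_add, Finsupp.degree_single] at hABC ⊢
  exact LeadingAssociated.trans ⟨-q, neg_ne_zero.2 hq, hΩ⟩ hABC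

/-- The exponents `((i₀, i₁, i₂), (j₀, j₁, j₂), ℓ)`, with `ℓ < n`, of the monomials
`UAW.monomial F q n i₀ i₁ i₂ j₀ j₁ j₂ ℓ` that form a basis of the center. -/
abbrev MonomialIndex (n : ℕ) : Type :=
  (ℕ × ℕ × ℕ) × (ℕ × ℕ × ℕ) × Fin n

/-- The exponent of the leading term of the monomial with a given index: `T_n(A)` contributes
`A ^ n` and `Ω` contributes `A * B * C`. -/
noncomputable def leadingExponent : MonomialIndex n → UAWGen →₀ ℕ
  | ((i₀, i₁, i₂), (j₀, j₁, j₂), ℓ) =>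
    i₀ • n • .single .A 1 + i₁ • n • .single .B 1 + i₂ • n • .single .C 1
      + j₀ • .single .α 1 + j₁ • .single .β 1 + j₂ • .single .γ 1
      + (ℓ : ℕ) • (.single .A 1 + .single .B 1 + .single .C 1)

theorem leadingExponent_eq_iff {i₀ i₁ i₂ j₀ j₁ j₂ : ℕ} {ℓ : Fin n} {e : UAWGen →₀ ℕ} :
    leadingExponent ((i₀, i₁, i₂), (j₀, j₁, j₂), ℓ) = e ↔
      (i₀ * n + ℓ = e .A ∧ i₁ * n + ℓ = e .B ∧ i₂ * n + ℓ = e .C) ∧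
        j₀ = e .α ∧ j₁ = e .β ∧ j₂ = e .γ := by
  have hforall (p : UAWGen → Prop) :
      (∀ g, p g) ↔ (p .A ∧ p .B ∧ p .C) ∧ p .α ∧ p .β ∧ p .γ :=
    ⟨fun h => ⟨⟨h _, h _, h _⟩, h _, h _, h _⟩, fun ⟨⟨hA, hB, hC⟩, hα, hβ, hγ⟩ g => by
      cases g <;> assumption⟩
  rw [DFunLike.ext_iff, hforall]
  simp [leadingExponent]

theorem hasLeadingExponent_monomial (hq : q ≠ 0) (i₀ i₁ i₂ j₀ j₁ j₂ : ℕ) (ℓ : Fin n) :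
    HasLeadingExponent (monomial F q n i₀ i₁ i₂ j₀ j₁ j₂ ℓ)
      (leadingExponent ((i₀, i₁, i₂), (j₀, j₁, j₂), ℓ)) :=
  have hT (g : UAWGen) := hasLeadingExponent_T_gen (F := F) hq ℓ.pos g
  ((((((((hT .A).pow hq i₀).mul hq ((hT .B).pow hq i₁)).mul hq ((hT .C).pow hq i₂)).mul hq
    ((hasLeadingExponent_gen .α).pow hq j₀)).mul hq ((hasLeadingExponent_gen .β).pow hq j₁)).mul hq
    ((hasLeadingExponent_gen .γ).pow hq j₂)).mul hq ((hasLeadingExponent_Ω hq).pow hq ℓ))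

theorem leadingExponent_injective : Function.Injective (leadingExponent (n := n)) := by
  rintro ⟨⟨i₀, i₁, i₂⟩, ⟨j₀, j₁, j₂⟩, ℓ⟩ ⟨⟨i₀', i₁', i₂'⟩, ⟨j₀', j₁', j₂'⟩, ℓ'⟩ h
  have : NeZero n := ⟨ℓ.pos.ne'⟩
  have hdivMod {i i' : ℕ} (hi : i * n + ℓ = i' * n + ℓ') : i = i' ∧ ℓ = ℓ' :=
    Prod.mk.inj ((Nat.divModEquiv n).symm.injective (a₁ := (i, ℓ)) (a₂ := (i', ℓ')) hi)
  obtain ⟨⟨hA, hB, hC⟩, hα, hβ, hγ⟩ := leadingExponent_eq_iff.1 h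
  obtain ⟨⟨hA', hB', hC'⟩, hα', hβ', hγ'⟩ := leadingExponent_eq_iff.1
    (Eq.refl (leadingExponent ((i₀', i₁', i₂'), (j₀', j₁', j₂'), ℓ')))
  obtain ⟨rfl, rfl⟩ := hdivMod (hA.trans hA'.symm)
  obtain ⟨rfl, -⟩ := hdivMod (hB.trans hB'.symm)
  obtain ⟨rfl, -⟩ := hdivMod (hC.trans hC'.symm)
  rw [hα.trans hα'.symm, hβ.trans hβ'.symm, hγ.trans hγ'.symm]

theorem IsCentralExponent.mem_range_leadingExponent (hn : 0 < n) {e : UAWGen →₀ ℕ}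
    (he : IsCentralExponent n e) : e ∈ Set.range (leadingExponent (n := n)) := by
  have hdivMod {k : ℕ} (hk : e .A ≡ k [MOD n]) : k / n * n + e .A % n = k := by
    rw [hk, Nat.div_add_mod']
  exact ⟨((e .A / n, e .B / n, e .C / n), (e .α, e .β, e .γ), ⟨e .A % n, Nat.mod_lt _ hn⟩),
    leadingExponent_eq_iff.2 ⟨⟨hdivMod rfl, hdivMod he.1, hdivMod (he.1.trans he.2)⟩, rfl, rfl,
      rfl⟩⟩

end LeadingExponents

section CentralMonomials

theorem sixElements_subset_center (hq : q ≠ 0) (hn : IsPrimitiveRoot (q ^ 2) n) :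
    sixElements F q n ⊆ Subalgebra.center F (UAW F q) := by
  rintro _ (rfl | rfl | rfl | rfl | rfl | rfl)
  exacts [T_A_mem_center hq hn, T_B_mem_center hq hn, T_C_mem_center hq hn, α_mem_center F q,
    β_mem_center F q, γ_mem_center F q]

/-- The family of the monomials in `T_n(A)`, `T_n(B)`, `T_n(C)`, `α`, `β`, `γ` and `Ω` as elements
of the center. The first six factors form a coefficient of the power of `Ω` in
`UAW.centralSubalgebra F q n`. -/
noncomputable def centralMonomial (hq : q ≠ 0) (hn : IsPrimitiveRoot (q ^ 2) n) :
    MonomialIndex n → Subalgebra.center F (UAW F q)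
  | ((i₀, i₁, i₂), (j₀, j₁, j₂), ℓ) =>
    ⟨T F q n (A F q), T_A_mem_center hq hn⟩ ^ i₀ * ⟨T F q n (B F q), T_B_mem_center hq hn⟩ ^ i₁
      * ⟨T F q n (C F q), T_C_mem_center hq hn⟩ ^ i₂ * ⟨α F q, α_mem_center F q⟩ ^ j₀
      * ⟨β F q, β_mem_center F q⟩ ^ j₁ * ⟨γ F q, γ_mem_center F q⟩ ^ j₂
      * ⟨Ω F q, Ω_mem_center hq⟩ ^ (ℓ : ℕ)

theorem coe_centralMonomial (hq : q ≠ 0) (hn : IsPrimitiveRoot (q ^ 2) n)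
    (i₀ i₁ i₂ j₀ j₁ j₂ : ℕ) (ℓ : Fin n) :
    (centralMonomial hq hn ((i₀, i₁, i₂), (j₀, j₁, j₂), ℓ) : UAW F q) =
      monomial F q n i₀ i₁ i₂ j₀ j₁ j₂ ℓ :=
  rfl

variable (hq : q ≠ 0) (hn : IsPrimitiveRoot (q ^ 2) n)
include hq hn

theorem hasLeadingExponent_centralMonomial (τ : MonomialIndex n) :
    HasLeadingExponent (centralMonomial hq hn τ : UAW F q) (leadingExponent τ) :=
  hasLeadingExponent_monomial hq _ _ _ _ _ _ _

theorem linearIndependent_centralMonomial : LinearIndependent F (centralMonomial hq hn) :=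
  .of_comp (Subalgebra.center F (UAW F q)).val.toLinearMap
    (linearIndependent_of_hasLeadingExponent hq leadingExponent_injective
      (hasLeadingExponent_centralMonomial hq hn))

theorem span_centralMonomial (hn₀ : 0 < n) :
    Submodule.span F (Set.range (centralMonomial hq hn)) = ⊤ := by
  let val := (Subalgebra.center F (UAW F q)).val.toLinearMap
  have hcenter := center_le_span_of_hasLeadingExponent hq hn
    (fun τ => (centralMonomial hq hn τ).2) (hasLeadingExponent_centralMonomial hq hn)
    fun _ he => he.mem_range_leadingExponent hn₀
  have hmap : (Submodule.span F (Set.range (centralMonomial hq hn))).map val =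
      Submodule.span F (Set.range fun τ => (centralMonomial hq hn τ : UAW F q)) := by
    rw [Submodule.map_span, ← Set.range_comp]
    rfl
  refine eq_top_iff.2 fun z _ => ?_
  obtain ⟨y, hy, hyz⟩ := hmap ▸ hcenter z.2
  exact Subtype.ext hyz ▸ hy

theorem centralMonomial_mem_span_Ω_pow (τ : MonomialIndex n) :
    centralMonomial hq hn τ ∈ Submodule.span (centralSubalgebra F q n)
      (Set.range fun ℓ : Fin n =>
        (⟨Ω F q, Ω_mem_center hq⟩ : Subalgebra.center F (UAW F q)) ^ (ℓ : ℕ)) := by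
  obtain ⟨⟨i₀, i₁, i₂⟩, ⟨j₀, j₁, j₂⟩, ℓ⟩ := τ
  have hmem {x : UAW F q} (hx : x ∈ sixElements F q n) (hc : x ∈ Subalgebra.center F (UAW F q))
      (k : ℕ) : (⟨x, hc⟩ ^ k : Subalgebra.center F (UAW F q)) ∈ centralSubalgebra F q n :=
    have hadjoin : (⟨x, hc⟩ : Subalgebra.center F (UAW F q)) ∈ centralSubalgebra F q n :=
      Algebra.subset_adjoin hx
    pow_mem hadjoin k
  have hcoeff := mul_mem (mul_mem (mul_mem (mul_mem (mul_mem
    (hmem (by simp [sixElements]) (T_A_mem_center hq hn) i₀)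
    (hmem (by simp [sixElements]) (T_B_mem_center hq hn) i₁))
    (hmem (by simp [sixElements]) (T_C_mem_center hq hn) i₂))
    (hmem (by simp [sixElements]) (α_mem_center F q) j₀))
    (hmem (by simp [sixElements]) (β_mem_center F q) j₁))
    (hmem (by simp [sixElements]) (γ_mem_center F q) j₂)
  exact Submodule.smul_mem _ (⟨_, hcoeff⟩ : centralSubalgebra F q n)
    (Submodule.subset_span ⟨ℓ, rfl⟩)

theorem finite_center (hn₀ : 0 < n) :
    Module.Finite (centralSubalgebra F q n) (Subalgebra.center F (UAW F q)) := by
  have hle := Submodule.span_le.2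
    (Set.range_subset_iff.2 (centralMonomial_mem_span_Ω_pow hq hn))
  rw [Submodule.span_eq_top_of_span_eq_top F _ _ (span_centralMonomial hq hn hn₀)] at hle
  exact ⟨Submodule.fg_def.2 ⟨_, Set.finite_range _, top_le_iff.1 hle⟩⟩

end CentralMonomials

end UAW

theorem mainTheorem9 (F : Type*) [Field F] (d : ℕ) (hd : 0 < d) (q : F)
    (hq : IsPrimitiveRoot q d) :
    (∃ b : Module.Basis ((ℕ × ℕ × ℕ) × (ℕ × ℕ × ℕ) × Fin (UAW.dbar d)) F
        (Subalgebra.center F (UAW F q)),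
      ∀ (i₀ i₁ i₂ j₀ j₁ j₂ : ℕ) (ℓ : Fin (UAW.dbar d)),
        (b ((i₀, i₁, i₂), (j₀, j₁, j₂), ℓ) : UAW F q) =
          UAW.monomial F q (UAW.dbar d) i₀ i₁ i₂ j₀ j₁ j₂ ℓ) ∧
    UAW.sixElements F q (UAW.dbar d) ⊆ Subalgebra.center F (UAW F q) ∧
    Algebra.IsIntegral (UAW.centralSubalgebra F q (UAW.dbar d))
      (Subalgebra.center F (UAW F q)) := by
  have hq₀ : q ≠ 0 := hq.ne_zero hd.ne'
  have hroot := UAW.isPrimitiveRoot_sq_dbar hd hq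
  have hspan := UAW.span_centralMonomial hq₀ hroot (UAW.dbar_pos hd)
  have := UAW.finite_center hq₀ hroot (UAW.dbar_pos hd)
  refine ⟨⟨.mk (UAW.linearIndependent_centralMonomial hq₀ hroot) hspan.ge,
    fun i₀ i₁ i₂ j₀ j₁ j₂ ℓ => ?_⟩, UAW.sixElements_subset_center hq₀ hroot,
    Algebra.IsIntegral.of_finite _ _⟩
  rw [Module.Basis.mk_apply, UAW.coe_centralMonomial]
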